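/- **Setting.** Let $Q$ be a smooth finite-dimensional manifold, $L:TQ\to\mathbb R$ a smooth regular Lagrangian (the fibre Hessian $\partial^2L/\partial v^i\partial v^j$ is everywhere nondegenerate) and $F:TQ\to T^*Q$ a smooth fibre-preserving map (external force). Let $R:TQ\to Q$ be a retraction (smooth, $R_q(0_q)=q$, $T_{0_q}R_q=\mathrm{id}$) and let $(q,Q)\mapsto(q,\tau(q,Q))$ be the local inverse of $\sigma(v_q)=(q,R(v_q))$, mapping an open neighbourhood $U$ of the diagonal of $Q\times Q$ onto a neighbourhood of the zero section. On $TQ\times TQ\cong T(Q\times Q)$ put $$\widetilde K_F(v_q,V_Q)=\tfrac12\langle F(V_Q),\tau(Q,q)\rangle-\tfrac12\langle F(v_q),\tau(q,Q)\rangle,\qquad \mathbf L_{\widetilde K_F}(v_q,V_Q)=L(V_Q)-L(v_q)-\widetilde K_F(v_q,V_Q).$$ Fix $h>0$. Let $W\subseteq Q\times Q$ be an open set of endpoints such that for $(q_0,q_1)\in W$ there is a unique solution $q_{0,1}(t)$, $t\in[0,h]$, of the forced Euler–Lagrange equations $\frac{d}{dt}\frac{\partial L}{\partial v}-\frac{\partial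 L}{\partial q}=F$ with $q_{0,1}(0)=q_0$, $q_{0,1}(h)=q_1$, depending in a $C^2$ way on $(q_0,q_1,t)$; uniqueness is among solutions whose velocities stay in a given open set $O\subseteq TQ$. Likewise let $W_2$ be an open set of endpoints $((q_0,Q_0),(q_1,Q_1))$, containing $((q_0,q_0),(q_1,q_1))$ for all $(q_0,q_1)\in W$, for which there is a unique solution $(q(t),Q(t))$ of the (free) Euler–Lagrange equations of $\mathbf L_{\widetilde K_F}$ on $[0,h]$ with these endpoints, depending in a $C^2$ way on the endpoints and $t$; uniqueness is among solutions with velocities in an open set $O_2\subseteq TQ\times TQ$ that contains $(v,v)$ for $v\in O$ and lies over pairs with $(q,Q),(Q,q)\in U$. The Marsden–West exact forced discrete Lagrangian of $(L,F)$ consists of $$L_d^e(q_0,q_1)=\int_0^hL(q_{0,1},\dot q_{0,1})\,dt,\quad f_d^{e-}(q_0,q_1)=\int_0^hF(q_{0,1},\dot q_{0,1})\cdot\frac{\partial q_{0,1}}{\partial q_0}\,dt,\quad f_d^{e+}(q_0,q_1)=\int_0^hF(q_{0,1},\dot q_{0,1})\cdot\frac{\partial q_{0,1}}{\partial q_1}\,dt,$$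 and the exact discrete Lagrangian of the duplicated system is $$\mathbf L^e_{\widetilde K_F}(q_0,Q_0,q_1,Q_1)=\int_0^h\mathbf L_{\widetilde K_F}(q,\dot q,Q,\dot Q)\,dt .$$ **Proposition.** For every $(q_0,q_1)\in W$, at the identity $\tilde\epsilon_d(q_0,q_1)$, i.e. $Q_0=q_0$, $Q_1=q_1$: 1. the duplicated solution is $(q(t),Q(t))=(q_{0,1}(t),q_{0,1}(t))$, and $\mathbf L^e_{\widetilde K_F}=0$; 2. $L_d^e$ is differentiable at $(q_0,q_1)$ and $\mathbf L^e_{\widetilde K_F}$ at $\tilde\epsilon_d(q_0,q_1)$, where $$\frac{\partial\mathbf L^e_{\widetilde K_F}}{\partial Q_0}=-\frac{\partial\mathbf L^e_{\widetilde K_F}}{\partial q_0}=D_1L_d^e+f_d^{e-},\qquad \frac{\partial\mathbf L^e_{\widetilde K_F}}{\partial Q_1}=-\frac{\partial\mathbf L^e_{\widetilde K_F}}{\partial q_1}=D_2L_d^e+f_d^{e+};$$ 3. $\widetilde K_F$ generates the exact discrete forces: the function $\widetilde K_d(q_0,Q_0,q_1,Q_1)=\int_0^h\widetilde K_F(\dot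 q(t),\dot Q(t))\,dt$, where $q$ and $Q$ are the solutions of the *forced* system with endpoints $(q_0,q_1)$ and $(Q_0,Q_1)$, is differentiable at $\tilde\epsilon_d(q_0,q_1)$, with $$\frac{\partial\widetilde K_d}{\partial q_0}=-\frac{\partial\widetilde K_d}{\partial Q_0}=f_d^{e-},\qquad \frac{\partial\widetilde K_d}{\partial q_1}=-\frac{\partial\widetilde K_d}{\partial Q_1}=f_d^{e+};$$ 4. the function $\widetilde K_d^e(q_0,Q_0,q_1,Q_1)=\int_0^h\widetilde K_F(\dot q(t),\dot Q(t))\,dt$, where $(q,Q)$ is the solution of the *duplicated* system with these endpoints, is differentiable at $\tilde\epsilon_d(q_0,q_1)$, and its derivative along any variation $\Delta$ of the four endpoints is $$d\widetilde K^e_d\cdot\Delta=\int_0^hF(q_{0,1},\dot q_{0,1})\cdot\bigl(\partial_\Delta q(t)-\partial_\Delta Q(t)\bigr)\,dt .$$ Consequently the discrete Euler–Lagrange equations of $\mathbf L^e_{\widetilde K_F}$ at the identities are two copies, with opposite signs, of the forced discrete Euler–Lagrange equations of Marsden and West: if $(x,y),(y,z)\in W$, the $Q$-component (resp. the $q$-component)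 of $D_1\mathbf L^e_{\widetilde K_F}+D_2\mathbf L^e_{\widetilde K_F}$ at the consecutive points $(x,x),(y,y),(z,z)$ is plus (resp. minus) $$D_1L_d^e(y,z)+D_2L_d^e(x,y)+f_d^{e-}(y,z)+f_d^{e+}(x,y).$$ In particular, for a sequence $q_0,\dots,q_n$ with $(q_k,q_{k+1})\in W$ for all $k<n$, $((q_k,q_k))_k$ solves the discrete Euler–Lagrange equations of $\mathbf L^e_{\widetilde K_F}$ if and only if $(q_k)_k$ solves the forced discrete Euler–Lagrange equations of $(L_d^e,f_d^{e\pm})$. -/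

import Mathlib

open Set Bundle
open scoped Manifold ContDiff Interval

noncomputable section

namespace ForcedLagrangian

section Continuous

variable {E : Type*} [NormedAddCommGroup E] [NormedSpace ℝ E]
  {H : Type*} [TopologicalSpace H] {I : ModelWithCorners ℝ E H}
  {M : Type*} [TopologicalSpace M] [ChartedSpace H M]

/-- An external force: a fibre-preserving map `F : TM → T^*M`, written as the family of
covectors `F(v) ∈ T^*_{π(v)} M`. -/
abbrev Force (I : ModelWithCorners ℝ E H) (M : Type*) [TopologicalSpace M] [ChartedSpace H M] :=
  ∀ v : TangentBundle I M, TangentSpace I v.proj →L[ℝ] ℝ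

/-- The covector `F(v)` read in the model space `E`, to which `TangentSpace I v.proj` unfolds. -/
def Force.toModel (F : Force I M) (v : TangentBundle I M) : E →L[ℝ] ℝ := F v

/-- The zero force. -/
def noForce : Force I M := fun _ => 0

/-- The velocity lift `t ↦ ċ(t) ∈ TM` of a curve on `[0, h]` (one-sided derivatives at the two
ends). -/
def velocity (h : ℝ) (c : ℝ → M) (t : ℝ) : TangentBundle I M :=
  ⟨c t, mfderivWithin 𝓘(ℝ, ℝ) I c (Icc 0 h) t (1 : ℝ)⟩

variable [IsManifold I ∞ M]

/-- The local expression `ℓ(q, v)` of a Lagrangian in the tangent chart induced by the preferred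
chart of `M` at `x`. -/
def localLagrangian (L : TangentBundle I M → ℝ) (x : M) : E × E → ℝ :=
  fun z => L ((extChartAt I.tangent (⟨x, 0⟩ : TangentBundle I M)).symm z)

/-- The coordinates `(q(s), q̇(s))` of the velocity lift of `c` in the tangent chart induced by the
preferred chart of `M` at `x`. -/
def localVelocity (I : ModelWithCorners ℝ E H) [IsManifold I ∞ M]
    (h : ℝ) (c : ℝ → M) (x : M) (s : ℝ) : E × E :=
  extChartAt I.tangent (⟨x, 0⟩ : TangentBundle I M) (velocity (I := I) h c s)

/-- `∂ℓ/∂q`. -/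
def dPos (l : E × E → ℝ) (z : E × E) : E →L[ℝ] ℝ :=
  (fderiv ℝ l z).comp (ContinuousLinearMap.inl ℝ E E)

/-- `∂ℓ/∂v`. -/
def dVel (l : E × E → ℝ) (z : E × E) : E →L[ℝ] ℝ :=
  (fderiv ℝ l z).comp (ContinuousLinearMap.inr ℝ E E)

/-- `c` is a `C²` solution on `[0, h]` of the forced Euler-Lagrange equations
`d/dt (∂L/∂v) - ∂L/∂q = F`. At each time `t` the equation is written in the preferred chart at
`c t`, in which the coordinate expression of a covector at `c t` is the covector itself, because
`TangentSpace I (c t)` is `E` via that chart. -/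
structure IsSolution (L : TangentBundle I M → ℝ) (F : Force I M) (h : ℝ) (c : ℝ → M) :
    Prop where
  contMDiffOn : ContMDiffOn 𝓘(ℝ, ℝ) I 2 c (Icc 0 h)
  eulerLagrange : ∀ t ∈ Icc (0 : ℝ) h,
    HasDerivWithinAt
      (fun s => dVel (localLagrangian L (c t)) (localVelocity I h c (c t) s))
      (dPos (localLagrangian L (c t)) (localVelocity I h c (c t) t)
        + F.toModel (velocity h c t))
      (Icc 0 h) t

/-- `γ` gives, for endpoints `(q₀, q₁)` in the open set `W`, *the* solution `t ↦ γ (q₀, q₁) t` of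
the forced Euler-Lagrange equations on `[0, h]` joining `q₀` to `q₁`: it is the only solution with
these endpoints whose velocities stay in the open set `O ⊆ TM` (`O` may be all of `TM`), and it
depends in a `C²` way on the endpoints and time. -/
structure IsBoundaryValueFamily (L : TangentBundle I M → ℝ) (F : Force I M) (h : ℝ)
    (O : Set (TangentBundle I M)) (W : Set (M × M)) (γ : M × M → ℝ → M) : Prop where
  isOpen_velocities : IsOpen O
  isOpen_endpoints : IsOpen W
  contMDiffOn : ContMDiffOn ((I.prod I).prod 𝓘(ℝ, ℝ)) I 2
    (fun z : (M × M) × ℝ => γ z.1 z.2) (W ×ˢ Icc 0 h)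
  isSolution : ∀ p ∈ W, IsSolution L F h (γ p)
  velocity_mem : ∀ p ∈ W, ∀ t ∈ Icc (0 : ℝ) h, velocity h (γ p) t ∈ O
  start : ∀ p ∈ W, γ p 0 = p.1
  finish : ∀ p ∈ W, γ p h = p.2
  unique : ∀ p ∈ W, ∀ c : ℝ → M, IsSolution L F h c → c 0 = p.1 → c h = p.2 →
    (∀ t ∈ Icc (0 : ℝ) h, velocity h c t ∈ O) → EqOn c (γ p) (Icc 0 h)

/-- Regularity of a Lagrangian: the fibre Hessian `∂²L/∂vⁱ∂vʲ` is nondegenerate everywhere. -/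
def IsRegularLagrangian (L : TangentBundle I M → ℝ) : Prop :=
  ∀ (q : M) (v a : E),
    (∀ b : E, fderiv ℝ (fderiv ℝ (fun w : E => L (⟨q, w⟩ : TangentBundle I M))) v a b = 0) → a = 0

/-- Smoothness of a force, as a map from `TM` to the total space of the cotangent bundle. -/
def IsSmoothForce (F : Force I M) : Prop :=
  ContMDiff I.tangent (I.prod 𝓘(ℝ, E →L[ℝ] ℝ)) ∞
    (fun v : TangentBundle I M =>
      (TotalSpace.mk' (E →L[ℝ] ℝ) v.proj (F v) :
        TotalSpace (E →L[ℝ] ℝ) (fun q : M => TangentSpace I q →L[ℝ] Bundle.Trivial M ℝ q)))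

/-- A retraction `R : TM → M`: smooth, `R_q(0_q) = q` and `T_{0_q} R_q = id`. -/
structure IsRetraction (R : TangentBundle I M → M) : Prop where
  contMDiff : ContMDiff I.tangent I ∞ R
  map_zero : ∀ q : M, R ⟨q, 0⟩ = q
  mfderiv_zero : ∀ (q : M) (w : E),
    (mfderiv 𝓘(ℝ, E) I (fun u : E => R (⟨q, u⟩ : TangentBundle I M)) 0 w : E) = w

/-- `(q, Q) ↦ (q, τ q Q)` is the smooth local inverse of `σ(v_q) = (q, R(v_q))`, from the
neighbourhood `U` of the diagonal to the neighbourhood `Z` of the zero section. -/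
structure IsLocalInverse (R : TangentBundle I M → M) (τ : ∀ q : M, M → TangentSpace I q)
    (Z : Set (TangentBundle I M)) (U : Set (M × M)) : Prop where
  isOpen_source : IsOpen Z
  isOpen_target : IsOpen U
  zero_mem : ∀ q : M, (⟨q, 0⟩ : TangentBundle I M) ∈ Z
  left_inv : ∀ v ∈ Z, (v.proj, R v) ∈ U ∧ τ v.proj (R v) = v.2
  right_inv : ∀ x ∈ U, (⟨x.1, τ x.1 x.2⟩ : TangentBundle I M) ∈ Z ∧ R ⟨x.1, τ x.1 x.2⟩ = x.2
  contMDiffOn : ContMDiffOn (I.prod I) I.tangent ∞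
    (fun x : M × M => (⟨x.1, τ x.1 x.2⟩ : TangentBundle I M)) U

/-- The generalized potential
`K̃_F(v_q, V_Q) = ½ ⟨F(V_Q), τ(Q, q)⟩ - ½ ⟨F(v_q), τ(q, Q)⟩`. -/
def potential (F : Force I M) (τ : ∀ q : M, M → TangentSpace I q) (v V : TangentBundle I M) : ℝ :=
  1 / 2 * F V (τ V.proj v.proj) - 1 / 2 * F v (τ v.proj V.proj)

/-- The duplicated Lagrangian `𝐋_{K̃_F}(v_q, V_Q) = L(V_Q) - L(v_q) - K̃_F(v_q, V_Q)`, as a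
function on `T(M × M) ≅ TM × TM`. -/
def dupLagrangian (L : TangentBundle I M → ℝ) (F : Force I M)
    (τ : ∀ q : M, M → TangentSpace I q) (w : TangentBundle (I.prod I) (M × M)) : ℝ :=
  let p := equivTangentBundleProd I M I M w
  L p.2 - L p.1 - potential F τ p.1 p.2

/-- The identities `v ↦ (v, v)`, `TM → TM × TM ≅ T(M × M)`. -/
def tangentIdentity (v : TangentBundle I M) : TangentBundle (I.prod I) (M × M) :=
  (equivTangentBundleProd I M I M).symm (v, v)

end Continuous

section Discrete

variable {E : Type*} [NormedAddCommGroup E] [NormedSpace ℝ E]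
  {H : Type*} [TopologicalSpace H] {I : ModelWithCorners ℝ E H}
  {M : Type*} [TopologicalSpace M] [ChartedSpace H M]

/-- The discrete identities, `(q₀, q₁) ↦ ((q₀, q₀), (q₁, q₁))`, where an element of
`(M × M) × (M × M)` is the pair of endpoints `((q₀, Q₀), (q₁, Q₁))` of a curve in `M × M`. -/
def discreteIdentity (p : M × M) : (M × M) × (M × M) := ((p.1, p.1), (p.2, p.2))

/-- The exact discrete Lagrangian `(q₀, q₁) ↦ ∫₀ʰ L(q(t), q̇(t)) dt`, where `q(t) = γ (q₀, q₁) t`. -/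
def exactLagrangian (L : TangentBundle I M → ℝ) (h : ℝ) (γ : M × M → ℝ → M) (p : M × M) : ℝ :=
  ∫ t in (0 : ℝ)..h, L (velocity h (γ p) t)

/-- The exact discrete force `f_d^{e-}(q₀, q₁) = ∫₀ʰ F(q(t), q̇(t)) · ∂q(t)/∂q₀ dt ∈ T^*_{q₀} M`. -/
def exactForceMinus (F : Force I M) (h : ℝ) (γ : M × M → ℝ → M) (p : M × M)
    (δ : TangentSpace I p.1) : ℝ :=
  ∫ t in (0 : ℝ)..h, F (velocity h (γ p) t) (mfderiv I I (fun x : M => γ (x, p.2) t) p.1 δ)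

/-- The exact discrete force `f_d^{e+}(q₀, q₁) = ∫₀ʰ F(q(t), q̇(t)) · ∂q(t)/∂q₁ dt ∈ T^*_{q₁} M`. -/
def exactForcePlus (F : Force I M) (h : ℝ) (γ : M × M → ℝ → M) (p : M × M)
    (δ : TangentSpace I p.2) : ℝ :=
  ∫ t in (0 : ℝ)..h, F (velocity h (γ p) t) (mfderiv I I (fun x : M => γ (p.1, x) t) p.2 δ)

/-- The differential of a real function on a manifold, `df(x) · δ`. -/
def differential (I : ModelWithCorners ℝ E H) (f : M → ℝ) (x : M) (δ : TangentSpace I x) : ℝ :=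
  mfderiv I 𝓘(ℝ, ℝ) f x δ

/-- The partial differential `D₁ L_d(q₀, q₁) ∈ T^*_{q₀} M`. -/
def D₁ (I : ModelWithCorners ℝ E H) (Ld : M × M → ℝ) (p : M × M) (δ : TangentSpace I p.1) : ℝ :=
  differential I (fun x : M => Ld (x, p.2)) p.1 δ

/-- The partial differential `D₂ L_d(q₀, q₁) ∈ T^*_{q₁} M`. -/
def D₂ (I : ModelWithCorners ℝ E H) (Ld : M × M → ℝ) (p : M × M) (δ : TangentSpace I p.2) : ℝ :=
  differential I (fun x : M => Ld (p.1, x)) p.2 δ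

/-- The left-hand side of the forced discrete Euler-Lagrange equations at three consecutive points
`x, y, z`:
`D₁ L_d(y, z) + D₂ L_d(x, y) + f_d^-(y, z) + f_d^+(x, y) ∈ T^*_y M`. -/
def forcedDEL (Ld : M × M → ℝ) (fm : ∀ p : M × M, TangentSpace I p.1 → ℝ)
    (fp : ∀ p : M × M, TangentSpace I p.2 → ℝ) (x y z : M) (δ : TangentSpace I y) : ℝ :=
  D₁ I Ld (y, z) δ + D₂ I Ld (x, y) δ + fm (y, z) δ + fp (x, y) δ

/-- The left-hand side `D₁ L_d(y, z) + D₂ L_d(x, y)` of the (unforced) discrete Euler-Lagrange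
equations. -/
def freeDEL (I : ModelWithCorners ℝ E H) (Ld : M × M → ℝ) (x y z : M) (δ : TangentSpace I y) : ℝ :=
  D₁ I Ld (y, z) δ + D₂ I Ld (x, y) δ

/-- The contribution of `K̃_F` along a pair of curves:
`((q₀, Q₀), (q₁, Q₁)) ↦ ∫₀ʰ K̃_F(q̇(t), Q̇(t)) dt`, where `q(t) = γ (q₀, q₁) t` and
`Q(t) = γ (Q₀, Q₁) t`. -/
def pairPotential (F : Force I M) (τ : ∀ q : M, M → TangentSpace I q) (h : ℝ)
    (γ : M × M → ℝ → M) (P : (M × M) × (M × M)) : ℝ :=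
  ∫ t in (0 : ℝ)..h,
    potential F τ (velocity h (γ (P.1.1, P.2.1)) t) (velocity h (γ (P.1.2, P.2.2)) t)

/-- The contribution of `K̃_F` to the exact discrete Lagrangian of the duplicated system:
`((q₀, Q₀), (q₁, Q₁)) ↦ ∫₀ʰ K̃_F(q̇(t), Q̇(t)) dt`, where `(q(t), Q(t)) = Γ ((q₀, Q₀), (q₁, Q₁)) t`. -/
def exactPotential (F : Force I M) (τ : ∀ q : M, M → TangentSpace I q) (h : ℝ)
    (Γ : (M × M) × (M × M) → ℝ → M × M) (P : (M × M) × (M × M)) : ℝ :=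
  ∫ t in (0 : ℝ)..h,
    potential F τ (velocity h (fun s => (Γ P s).1) t) (velocity h (fun s => (Γ P s).2) t)

/-- The variation `∂q(t)·Δ`, read in the model space `E`, of the first component of
`(q(t), Q(t)) = Γ P t` under a variation `Δ` of the endpoints `P`. -/
def variationFst (I : ModelWithCorners ℝ E H) (Γ : (M × M) × (M × M) → ℝ → M × M)
    (P : (M × M) × (M × M)) (t : ℝ)
    (Δ : TangentSpace ((I.prod I).prod (I.prod I)) P) : E :=
  mfderiv ((I.prod I).prod (I.prod I)) I (fun x => (Γ x t).1) P Δ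

/-- The variation `∂Q(t)·Δ`, read in the model space `E`, of the second component of
`(q(t), Q(t)) = Γ P t` under a variation `Δ` of the endpoints `P`. Where `q(t) = Q(t)` it lies in
the same tangent space as the variation of the first component. -/
def variationSnd (I : ModelWithCorners ℝ E H) (Γ : (M × M) × (M × M) → ℝ → M × M)
    (P : (M × M) × (M × M)) (t : ℝ)
    (Δ : TangentSpace ((I.prod I).prod (I.prod I)) P) : E :=
  mfderiv ((I.prod I).prod (I.prod I)) I (fun x => (Γ x t).2) P Δ

end Discrete

end ForcedLagrangian

end

open ForcedLagrangian

/-! Everything rests on the first-order behaviour of K̃_F along the identities. Since τ(q, q) = 0,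
K̃_F vanishes on every pair of vectors over a common base point, whatever the two velocities are.
Since τ(x, ·) inverts R_x, whose derivative at 0 is the identity, the differential of K̃_F at (v, v)
is F(v)·(δq − δQ) (`hasFDerivAt_localPotential`). Derivatives of F do not enter, being paired with τ
= 0, and neither do variations of the velocities.

Hence at (v, v) the momentum of the duplicated Lagrangian is ∂L/∂v composed with (δq, δQ) ↦ δQ − δq,
and its position derivative is ∂L/∂q + F composed with the same map (`dVel_dupLagrangian`,
`dPos_dupLagrangian`). A forced solution taken twice therefore solves the free duplicated equations
(`IsSolution.duplicate`), uniqueness identifies it with `Γ`, and the duplicated Lagrangian vanishes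
along it.

The differentials of both exact discrete Lagrangians come from one integrated first variation
formula (`hasMFDerivAt_action`): boundary momenta paired with the endpoint variations, minus the
work of the force. For the forced system it says that D₁L_d + f⁻ is minus the initial momentum and
D₂L_d + f⁺ is the final momentum. For the duplicated system there is no force, and the same momenta
appear with opposite signs on the two copies. Because the two sides are compared through boundary
momenta, the variation of `Γ` at intermediate times is not needed there.

The claims about ∫K̃_F are differentiation under the integral sign combined with the differential of
K̃_F (`hasMFDerivAt_integral_potential`). The discrete Euler-Lagrange equations add the
contributions of the two segments that meet at the middle point. -/

namespace ForcedLagrangian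

open Filter Topology

/-! ### Tangent charts and the coordinate invariance of the momentum. -/

section Charts

variable {E : Type*} [NormedAddCommGroup E] [NormedSpace ℝ E]
  {H : Type*} [TopologicalSpace H] {I : ModelWithCorners ℝ E H}
  {M : Type*} [TopologicalSpace M] [ChartedSpace H M]

/-- The fibre derivative of a Lagrangian. -/
noncomputable def fibreDeriv (L : TangentBundle I M → ℝ) (v : TangentBundle I M) : E →L[ℝ] ℝ :=
  fderiv ℝ (fun u : E => L (⟨v.proj, u⟩ : TangentBundle I M)) (v.2 : E)

/-- The differential at `q` of the preferred chart at `x`, read in the model space. -/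
noncomputable def chartDeriv (I : ModelWithCorners ℝ E H) (x q : M) : E →L[ℝ] E :=
  mfderiv I 𝓘(ℝ, E) (extChartAt I x) q

variable [IsManifold I ∞ M]

/-- The tangent chart of `TM` induced by the preferred chart of `M` at `x`. -/
noncomputable abbrev tangentChart (I : ModelWithCorners ℝ E H) {M : Type*} [TopologicalSpace M]
    [ChartedSpace H M] [IsManifold I ∞ M] (x : M) : PartialEquiv (TangentBundle I M) (E × E) :=
  extChartAt I.tangent (⟨x, 0⟩ : TangentBundle I M)

theorem chartDeriv_self (x : M) : chartDeriv I x x = ContinuousLinearMap.id ℝ E :=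
  mfderiv_extChartAt_self

theorem mem_tangentChart_source {x : M} {v : TangentBundle I M} :
    v ∈ (tangentChart I x).source ↔ v.proj ∈ (extChartAt I x).source := by
  simp [tangentChart, TangentBundle.mem_chart_source_iff]

theorem mem_tangentChart_target {x : M} {z : E × E} :
    z ∈ (tangentChart I x).target ↔ z.1 ∈ (extChartAt I x).target := by
  rw [tangentChart, FiberBundle.extChartAt_target]
  simp only [mem_prod, mem_univ, and_true, mem_inter_iff, mem_preimage]
  refine ⟨fun h => h.1, fun h => ⟨h, ?_⟩⟩
  have := (extChartAt I x).map_target h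
  simpa [extChartAt_source] using this

/-- The fibre coordinate is defined by the trivialization at `x`, which is the derivative of the
chart; in this form the chain rule applies to it. -/
theorem tangentChart_apply {x : M} {v : TangentBundle I M}
    (hv : v.proj ∈ (extChartAt I x).source) :
    tangentChart I x v = (extChartAt I x v.proj, chartDeriv I x v.proj v.2) := by
  have hv' : v.proj ∈ (chartAt H x).source := by simpa [extChartAt_source] using hv
  have h1 : chartDeriv I x v.proj v.2 = (trivializationAt E (TangentSpace I) x v).2 := by
    have := DFunLike.congr_fun (TangentBundle.continuousLinearMapAt_trivializationAt hv') v.2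
    refine this.symm.trans ?_
    rw [Trivialization.continuousLinearMapAt_apply,
      Trivialization.coe_linearMapAt_of_mem _ (by simpa using hv')]
  rw [h1, tangentChart, FiberBundle.extChartAt]
  simp

theorem tangentChart_self (v : TangentBundle I M) :
    tangentChart I v.proj v = (extChartAt I v.proj v.proj, v.2) := by
  rw [tangentChart_apply (mem_extChartAt_source _), chartDeriv_self]
  rfl

theorem tangentChart_symm_proj {x : M} {z : E × E} (hz : z.1 ∈ (extChartAt I x).target) :
    ((tangentChart I x).symm z).proj = (extChartAt I x).symm z.1 := by
  have hz' := mem_tangentChart_target.2 hz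
  have h1 := mem_tangentChart_source.1 ((tangentChart I x).map_target hz')
  have h2 := tangentChart_apply h1
  rw [(tangentChart I x).right_inv hz'] at h2
  have h3 := congrArg Prod.fst h2
  exact ((extChartAt I x).left_inv h1).symm.trans (congrArg _ h3.symm)

theorem tangentChart_symm_apply {x q : M} (hq : q ∈ (extChartAt I x).source) (w : E) :
    (tangentChart I x).symm (extChartAt I x q, chartDeriv I x q w)
      = (⟨q, w⟩ : TangentBundle I M) := by
  have := (tangentChart I x).left_inv (x := (⟨q, w⟩ : TangentBundle I M))
    (mem_tangentChart_source.2 hq)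
  rwa [tangentChart_apply hq] at this

theorem localLagrangian_tangentChart (L : TangentBundle I M → ℝ) {x : M}
    {v : TangentBundle I M} (hv : v.proj ∈ (extChartAt I x).source) :
    localLagrangian L x (tangentChart I x v) = L v := by
  rw [localLagrangian, (tangentChart I x).left_inv (mem_tangentChart_source.2 hv)]

theorem contMDiffAt_tangentChart {x : M} {v : TangentBundle I M}
    (hv : v.proj ∈ (extChartAt I x).source) :
    ContMDiffAt I.tangent 𝓘(ℝ, E × E) 1 (tangentChart I x) v := by
  refine contMDiffAt_extChartAt' ?_
  rw [TangentBundle.mem_chart_source_iff]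
  simpa [extChartAt_source] using hv

/-- Chain rule for chart after curve. Positivity of `h` makes one-sided derivatives on `[0, h]`
unique. -/
theorem localVelocity_eq {h : ℝ} (hh : 0 < h) {c : ℝ → M} {x : M} {s : ℝ}
    (hs : s ∈ Icc 0 h) (hc : MDifferentiableWithinAt 𝓘(ℝ, ℝ) I c (Icc 0 h) s)
    (hx : c s ∈ (extChartAt I x).source) :
    localVelocity I h c x s
      = (extChartAt I x (c s), derivWithin (fun r => extChartAt I x (c r)) (Icc 0 h) s) := by
  have hx' : c s ∈ (chartAt H x).source := by simpa [extChartAt_source] using hx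
  have hu : UniqueMDiffWithinAt 𝓘(ℝ, ℝ) (Icc 0 h) s :=
    (uniqueDiffOn_Icc hh s hs).uniqueMDiffWithinAt
  have h1 := mfderiv_comp_mfderivWithin s (mdifferentiableAt_extChartAt (I := I) hx') hc hu
  have h2 := tangentChart_apply (v := velocity (I := I) h c s) hx
  refine h2.trans (Prod.ext rfl ?_)
  rw [mfderivWithin_eq_fderivWithin] at h1
  exact (DFunLike.congr_fun h1 (1 : ℝ)).symm

variable [I.Boundaryless]

theorem contMDiffAt_tangentChart_symm {x : M} {z : E × E}
    (hz : z.1 ∈ (extChartAt I x).target) :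
    ContMDiffAt 𝓘(ℝ, E × E) I.tangent 1 (tangentChart I x).symm z :=
  (contMDiffOn_extChartAt_symm (I := I.tangent) _).contMDiffAt
    ((isOpen_extChartAt_target _).mem_nhds (mem_tangentChart_target.2 hz))

theorem contDiffAt_localLagrangian {L : TangentBundle I M → ℝ} {x : M}
    {v : TangentBundle I M} (hv : v.proj ∈ (extChartAt I x).source)
    (hL : ContMDiffAt I.tangent 𝓘(ℝ, ℝ) 1 L v) :
    ContDiffAt ℝ 1 (localLagrangian L x) (tangentChart I x v) := by
  rw [← contMDiffAt_iff_contDiffAt]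
  have hz : (tangentChart I x v).1 ∈ (extChartAt I x).target := by
    rw [tangentChart_apply hv]; exact (extChartAt I x).map_source hv
  refine ContMDiffAt.comp (g := L) _ ?_ (contMDiffAt_tangentChart_symm hz)
  rwa [(tangentChart I x).left_inv (mem_tangentChart_source.2 hv)]

/-- A tangent chart is linear on each fibre, so ∂L/∂v transforms as a covector. This is what allows
the chart used in the Euler-Lagrange equation to move with the point of the curve. -/
theorem dVel_localLagrangian {L : TangentBundle I M → ℝ} {x : M}
    {v : TangentBundle I M} (hv : v.proj ∈ (extChartAt I x).source)
    (hL : ContMDiffAt I.tangent 𝓘(ℝ, ℝ) 1 L v) (w : E) :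
    dVel (localLagrangian L x) (tangentChart I x v) (chartDeriv I x v.proj w)
      = fibreDeriv L v w := by
  set A : E →L[ℝ] E := chartDeriv I x v.proj with hA
  have h1 : (fun u : E => L (⟨v.proj, u⟩ : TangentBundle I M))
      = localLagrangian L x ∘ fun u : E => (extChartAt I x v.proj, A u) := by
    funext u
    exact congrArg L (tangentChart_symm_apply hv u).symm
  let u₀ : E := v.2
  have h2 : HasFDerivAt (localLagrangian L x)
      (fderiv ℝ (localLagrangian L x) (tangentChart I x v))
      (extChartAt I x v.proj, A u₀) := by
    have := ((contDiffAt_localLagrangian hv hL).differentiableAt one_ne_zero).hasFDerivAt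
    rwa [tangentChart_apply hv] at this ⊢
  have h3 : HasFDerivAt (fun u : E => (extChartAt I x v.proj, A u))
      ((0 : E →L[ℝ] E).prod A) u₀ :=
    (hasFDerivAt_const _ _).prodMk A.hasFDerivAt
  have h4 := (h2.comp u₀ h3).fderiv
  have h5 : fibreDeriv L v = fderiv ℝ (localLagrangian L x ∘
      fun u : E => (extChartAt I x v.proj, A u)) u₀ := by
    rw [fibreDeriv, h1]
  rw [h5, h4]
  simp [dVel]

end Charts

/-! ### Parameter derivatives and integrals over a closed time interval. -/

section Parametric

variable {X Y : Type*} [NormedAddCommGroup X] [NormedSpace ℝ X]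
  [NormedAddCommGroup Y] [NormedSpace ℝ Y] {V : Set X} {h : ℝ}

/-- Only time has a boundary: `V` is open, so a derivative within `V ×ˢ Icc 0 h` restricts to an
honest parameter derivative even at `t = 0` and `t = h`. -/
theorem hasFDerivAt_slice (hV : IsOpen V) {f : X × ℝ → Y} {e : X} {t : ℝ} (he : e ∈ V)
    (ht : t ∈ Icc 0 h) (hf : DifferentiableWithinAt ℝ f (V ×ˢ Icc 0 h) (e, t)) :
    HasFDerivAt (fun x => f (x, t))
      ((fderivWithin ℝ f (V ×ˢ Icc 0 h) (e, t)).comp (ContinuousLinearMap.inl ℝ X ℝ)) e := by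
  have h1 : HasFDerivWithinAt (fun x : X => (x, t)) (ContinuousLinearMap.inl ℝ X ℝ) V e :=
    (hasFDerivAt_prodMk_left e t).hasFDerivWithinAt
  have h2 : MapsTo (fun x : X => (x, t)) V (V ×ˢ Icc 0 h) := fun x hx => ⟨hx, ht⟩
  exact (hf.hasFDerivWithinAt.comp e h1 h2).hasFDerivAt (hV.mem_nhds he)

theorem hasDerivWithinAt_slice {f : X × ℝ → Y} {e : X} {t : ℝ} (he : e ∈ V)
    (hf : DifferentiableWithinAt ℝ f (V ×ˢ Icc 0 h) (e, t)) :
    HasDerivWithinAt (fun s => f (e, s)) (fderivWithin ℝ f (V ×ˢ Icc 0 h) (e, t) (0, 1))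
      (Icc 0 h) t := by
  have h1 : HasFDerivWithinAt (fun s : ℝ => (e, s)) (ContinuousLinearMap.inr ℝ X ℝ) (Icc 0 h) t :=
    (hasFDerivAt_prodMk_right e t).hasFDerivWithinAt
  have h2 := hf.hasFDerivWithinAt.comp t h1 fun x hx => ⟨he, hx⟩
  simpa [Function.comp_def] using h2.hasDerivWithinAt

theorem uniqueDiffOn_prod_Icc (hV : IsOpen V) (hh : 0 < h) :
    UniqueDiffOn ℝ (V ×ˢ Icc 0 h) :=
  hV.uniqueDiffOn.prod (uniqueDiffOn_Icc hh)

-- The condition under which second derivatives within the set are symmetric, at the end times as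
-- well.
omit [NormedSpace ℝ X] in
theorem mem_closure_interior_prod_Icc (hV : IsOpen V) (hh : 0 < h) {z : X × ℝ}
    (hz : z ∈ V ×ˢ Icc 0 h) : z ∈ closure (interior (V ×ˢ Icc 0 h)) := by
  rw [interior_prod_eq, closure_prod_eq, hV.interior_eq, interior_Icc, closure_Ioo hh.ne]
  exact ⟨subset_closure hz.1, hz.2⟩

/-- The slices of a function which is `C¹` near `{e} × [0, h]`, up to the boundary, have a
derivative at `e` which is continuous in time. -/
theorem continuousOn_fderiv_slice (hV : IsOpen V) (hh : 0 < h) {g : X × ℝ → Y} {e : X}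
    (he : e ∈ V)
    (hg : ∀ t ∈ Icc 0 h, ContDiffWithinAt ℝ 1 g (V ×ˢ Icc 0 h) (e, t)) :
    ContinuousOn (fun t => fderiv ℝ (fun x => g (x, t)) e) (Icc 0 h) := by
  have h1 : ContinuousOn (fun t => (fderivWithin ℝ g (V ×ˢ Icc 0 h) (e, t)).comp
      (ContinuousLinearMap.inl ℝ X ℝ)) (Icc 0 h) := by
    refine ContinuousOn.clm_comp (fun t ht => ?_) continuousOn_const
    have h2 := ((hg t ht).fderivWithin_right (m := 0) (uniqueDiffOn_prod_Icc hV hh)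
      (by norm_num) ⟨he, ht⟩).continuousWithinAt
    exact h2.comp (Continuous.prodMk_right e).continuousWithinAt fun s hs => ⟨he, hs⟩
  exact h1.congr fun t ht =>
    (hasFDerivAt_slice hV he ht ((hg t ht).differentiableWithinAt one_ne_zero)).fderiv

/-- Differentiation under the integral sign for a function which is `C¹` near `{e} × [0, h]`, up
to the boundary. -/
theorem hasFDerivAt_intervalIntegral (hV : IsOpen V) (hh : 0 < h) {g : X × ℝ → ℝ} {e : X}
    (he : e ∈ V)
    (hg : ∀ t ∈ Icc 0 h, ContDiffWithinAt ℝ 1 g (V ×ˢ Icc 0 h) (e, t)) :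
    HasFDerivAt (fun x => ∫ t in (0 : ℝ)..h, g (x, t))
      (∫ t in (0 : ℝ)..h, fderiv ℝ (fun x => g (x, t)) e) e := by
  have hU := uniqueDiffOn_prod_Icc (X := X) hV hh
  set S : Set (X × ℝ) := V ×ˢ Icc 0 h with hS
  have hI : Ι (0 : ℝ) h ⊆ Icc 0 h := by
    rw [uIoc_of_le hh.le]; exact Ioc_subset_Icc_self
  -- Being `C¹` at `(e, t)` spreads to a relative neighbourhood, and continuity of the derivative
  -- bounds its norm there by the value at `(e, t)` plus one.
  have key : ∀ t ∈ Icc 0 h, ∀ᶠ z : X × ℝ in 𝓝 (e, t), z ∈ S →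
      ContDiffWithinAt ℝ 1 g S z ∧
        ‖fderivWithin ℝ g S z‖ ≤ ‖fderivWithin ℝ g S (e, t)‖ + 1 := by
    intro t ht
    have hz : (e, t) ∈ S := ⟨he, ht⟩
    have h1 := (hg t ht).eventually (by simp)
    rw [insert_eq_of_mem hz] at h1
    have h2 := ((hg t ht).fderivWithin_right (m := 0) hU (by norm_num) hz).continuousWithinAt.norm
    have h3 := h2.eventually_le_const (lt_add_one _)
    exact eventually_nhdsWithin_iff.1 (h1.and h3)
  obtain ⟨C, hC⟩ : ∃ C, ∀ t ∈ Icc 0 h, ‖fderivWithin ℝ g S (e, t)‖ + 1 ≤ C := by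
    have : ContinuousOn (fun t => ‖fderivWithin ℝ g S (e, t)‖ + 1) (Icc 0 h) := by
      refine (ContinuousOn.norm fun t ht => ?_).add continuousOn_const
      have h2 := ((hg t ht).fderivWithin_right (m := 0) hU
        (by norm_num) ⟨he, ht⟩).continuousWithinAt
      exact h2.comp (Continuous.prodMk_right e).continuousWithinAt fun s hs => ⟨he, hs⟩
    obtain ⟨C, hC⟩ := (isCompact_Icc.image_of_continuousOn this).bddAbove
    exact ⟨C, fun t ht => hC (mem_image_of_mem _ ht)⟩
  -- Tube lemma: compactness of `[0, h]` yields one neighbourhood of `e` valid for all times, so the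
  -- constant `C` dominates.
  have hev : ∀ᶠ x in 𝓝 e, x ∈ V ∧ ∀ t ∈ Icc 0 h,
      ContDiffWithinAt ℝ 1 g S (x, t) ∧ ‖fderivWithin ℝ g S (x, t)‖ ≤ C := by
    have := isCompact_Icc.eventually_forall_of_forall_eventually (x₀ := e)
      (K := Icc (0 : ℝ) h)
      (P := fun x t => (x, t) ∈ S → ContDiffWithinAt ℝ 1 g S (x, t) ∧
        ‖fderivWithin ℝ g S (x, t)‖ ≤ C) fun t ht => by
          filter_upwards [key t ht] with z hz hzS
          exact ⟨(hz hzS).1, (hz hzS).2.trans (hC t ht)⟩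
    filter_upwards [this, hV.mem_nhds he] with x hx hxV
    exact ⟨hxV, fun t ht => hx t ht ⟨hxV, ht⟩⟩
  obtain ⟨s, hs, hsP⟩ := hev.exists_mem
  have hcont : ∀ x ∈ s, ContinuousOn (fun t => g (x, t)) (Icc 0 h) := fun x hx t ht =>
    (((hsP x hx).2 t ht).1.continuousWithinAt).comp
      (Continuous.prodMk_right x).continuousWithinAt fun r hr => ⟨(hsP x hx).1, hr⟩
  refine intervalIntegral.hasFDerivAt_integral_of_dominated_of_fderiv_le
    (bound := fun _ => C) (F' := fun x t => fderiv ℝ (fun y => g (y, t)) x) hs ?_ ?_ ?_ ?_ ?_ ?_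
  · filter_upwards [hs] with x hx
    exact ((hcont x hx).mono hI).aestronglyMeasurable measurableSet_uIoc
  · refine ContinuousOn.intervalIntegrable ?_
    rw [uIcc_of_le hh.le]
    exact hcont e (mem_of_mem_nhds hs)
  · exact ((continuousOn_fderiv_slice hV hh he hg).mono hI).aestronglyMeasurable
      measurableSet_uIoc
  · refine Eventually.of_forall fun t ht x hx => ?_
    obtain ⟨hxV, hx2⟩ := hsP x hx
    rw [(hasFDerivAt_slice hV hxV (hI ht)
      ((hx2 t (hI ht)).1.differentiableWithinAt one_ne_zero)).fderiv]
    refine (ContinuousLinearMap.opNorm_comp_le _ _).trans ?_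
    refine (mul_le_of_le_one_right (norm_nonneg _) (ContinuousLinearMap.norm_inl_le_one ..)).trans
      (hx2 t (hI ht)).2
  · exact intervalIntegrable_const
  · refine Eventually.of_forall fun t ht x hx => ?_
    obtain ⟨hxV, hx2⟩ := hsP x hx
    exact (hasFDerivAt_slice hV hxV (hI ht)
      ((hx2 t (hI ht)).1.differentiableWithinAt one_ne_zero)).differentiableAt.hasFDerivAt

theorem intervalIntegrable_fderiv_slice (hV : IsOpen V) (hh : 0 < h) {g : X × ℝ → ℝ} {e : X}
    (he : e ∈ V)
    (hg : ∀ t ∈ Icc 0 h, ContDiffWithinAt ℝ 1 g (V ×ˢ Icc 0 h) (e, t)) :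
    IntervalIntegrable (fun t => fderiv ℝ (fun x => g (x, t)) e) MeasureTheory.volume 0 h := by
  refine ContinuousOn.intervalIntegrable ?_
  rw [uIcc_of_le hh.le]
  exact continuousOn_fderiv_slice hV hh he hg

theorem intervalIntegral_fderiv_slice_apply (hV : IsOpen V) (hh : 0 < h) {g : X × ℝ → ℝ} {e : X}
    (he : e ∈ V)
    (hg : ∀ t ∈ Icc 0 h, ContDiffWithinAt ℝ 1 g (V ×ˢ Icc 0 h) (e, t)) (δ : X) :
    (∫ t in (0 : ℝ)..h, fderiv ℝ (fun x => g (x, t)) e) δ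
      = ∫ t in (0 : ℝ)..h, fderiv ℝ (fun x => g (x, t)) e δ :=
  ContinuousLinearMap.intervalIntegral_apply (intervalIntegrable_fderiv_slice hV hh he hg) δ

end Parametric

/-! ### The first variation along a `C²` family of curves. -/

section Variation

variable {E : Type*} [NormedAddCommGroup E] [NormedSpace ℝ E]
  {H : Type*} [TopologicalSpace H] {I : ModelWithCorners ℝ E H}
  {M : Type*} [TopologicalSpace M] [ChartedSpace H M]
  {X : Type*} [NormedAddCommGroup X] [NormedSpace ℝ X] {V : Set X} {h : ℝ}
  {c : X × ℝ → M}

/-- The variation field along the curve `c (e, ·)` of a family of curves, in the direction `δ`,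
read in the model space. -/
noncomputable def variationField (I : ModelWithCorners ℝ E H) (c : X × ℝ → M) (e : X) (t : ℝ) :
    X →L[ℝ] E :=
  mfderiv 𝓘(ℝ, X) I (fun x => c (x, t)) e

theorem mdifferentiableAt_slice (hV : IsOpen V) {e : X} {t : ℝ} (he : e ∈ V) (ht : t ∈ Icc 0 h)
    (hc : MDifferentiableWithinAt 𝓘(ℝ, X × ℝ) I c (V ×ˢ Icc 0 h) (e, t)) :
    MDifferentiableAt 𝓘(ℝ, X) I (fun x => c (x, t)) e := by
  have h1 : MDifferentiableWithinAt 𝓘(ℝ, X) 𝓘(ℝ, X × ℝ) (fun x : X => (x, t)) V e :=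
    (hasFDerivAt_prodMk_left e t).differentiableAt.mdifferentiableAt.mdifferentiableWithinAt
  have h2 : MapsTo (fun x : X => (x, t)) V (V ×ˢ Icc 0 h) := fun x hx => ⟨hx, ht⟩
  exact (MDifferentiableWithinAt.comp e hc h1 h2).mdifferentiableAt (hV.mem_nhds he)

theorem mdifferentiableWithinAt_slice {e : X} {t : ℝ} (he : e ∈ V)
    (hc : MDifferentiableWithinAt 𝓘(ℝ, X × ℝ) I c (V ×ˢ Icc 0 h) (e, t)) :
    MDifferentiableWithinAt 𝓘(ℝ, ℝ) I (fun s => c (e, s)) (Icc 0 h) t := by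
  have h1 : MDifferentiableWithinAt 𝓘(ℝ, ℝ) 𝓘(ℝ, X × ℝ) (fun s : ℝ => (e, s)) (Icc 0 h) t :=
    (hasFDerivAt_prodMk_right e t).differentiableAt.mdifferentiableAt.mdifferentiableWithinAt
  exact MDifferentiableWithinAt.comp t hc h1 fun x hx => ⟨he, hx⟩

variable [IsManifold I ∞ M]

theorem contDiffWithinAt_extChartAt_comp (hc : ContMDiffOn 𝓘(ℝ, X × ℝ) I 2 c (V ×ˢ Icc 0 h))
    {x : M} {z : X × ℝ} (hz : z ∈ V ×ˢ Icc 0 h) (hx : c z ∈ (extChartAt I x).source) :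
    ContDiffWithinAt ℝ 2 (fun y => extChartAt I x (c y)) (V ×ˢ Icc 0 h) z := by
  rw [← contMDiffWithinAt_iff_contDiffWithinAt]
  have hx' : c z ∈ (chartAt H x).source := by simpa [extChartAt_source] using hx
  exact (contMDiffAt_extChartAt' hx').comp_contMDiffWithinAt z (hc z hz)

/-- Velocity and variation are two directions, (0, 1) and (δ, 0), of a single derivative in
(parameter, time). Their interchange is then the symmetry of a second derivative. -/
theorem localVelocity_slice (hh : 0 < h)
    (hc : ContMDiffOn 𝓘(ℝ, X × ℝ) I 2 c (V ×ˢ Icc 0 h))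
    {x : M} {z : X × ℝ} (hz : z ∈ V ×ˢ Icc 0 h) (hx : c z ∈ (extChartAt I x).source) :
    localVelocity I h (fun s => c (z.1, s)) x z.2 = (extChartAt I x (c z),
      fderivWithin ℝ (fun y => extChartAt I x (c y)) (V ×ˢ Icc 0 h) z (0, 1)) := by
  rw [localVelocity_eq hh hz.2
    (mdifferentiableWithinAt_slice hz.1 ((hc z hz).mdifferentiableWithinAt two_ne_zero)) hx]
  refine Prod.ext rfl ?_
  exact (hasDerivWithinAt_slice hz.1 ((contDiffWithinAt_extChartAt_comp hc hz
    hx).differentiableWithinAt two_ne_zero)).derivWithin (uniqueDiffOn_Icc hh _ hz.2)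

theorem chartDeriv_variationField (hV : IsOpen V)
    (hc : ContMDiffOn 𝓘(ℝ, X × ℝ) I 2 c (V ×ˢ Icc 0 h))
    {x : M} {z : X × ℝ} (hz : z ∈ V ×ˢ Icc 0 h) (hx : c z ∈ (extChartAt I x).source) (δ : X) :
    chartDeriv I x (c z) (variationField I c z.1 z.2 δ)
      = fderivWithin ℝ (fun y => extChartAt I x (c y)) (V ×ˢ Icc 0 h) z (δ, 0) := by
  have hx' : c z ∈ (chartAt H x).source := by simpa [extChartAt_source] using hx
  have h1 := mfderiv_comp z.1 (mdifferentiableAt_extChartAt (I := I) hx')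
    (mdifferentiableAt_slice hV hz.1 hz.2 ((hc z hz).mdifferentiableWithinAt two_ne_zero))
  rw [mfderiv_eq_fderiv] at h1
  refine (DFunLike.congr_fun h1 δ).symm.trans ?_
  have h2 := (hasFDerivAt_slice hV hz.1 hz.2 ((contDiffWithinAt_extChartAt_comp hc hz
    hx).differentiableWithinAt two_ne_zero)).fderiv
  refine (DFunLike.congr_fun h2 δ).trans ?_
  simp

omit [IsManifold I ∞ M] in
theorem eventually_mem_source (hc : ContMDiffOn 𝓘(ℝ, X × ℝ) I 2 c (V ×ˢ Icc 0 h))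
    {x : M} {z : X × ℝ} (hz : z ∈ V ×ˢ Icc 0 h) (hx : c z ∈ (extChartAt I x).source) :
    ∀ᶠ y in 𝓝[V ×ˢ Icc 0 h] z, y ∈ V ×ˢ Icc 0 h ∧ c y ∈ (extChartAt I x).source :=
  eventually_mem_nhdsWithin.and ((hc z hz).continuousWithinAt.eventually_mem
    ((isOpen_extChartAt_source x).mem_nhds hx))

/-- One derivative is spent on the velocity, hence `C²` families and `C¹` integrands. -/
theorem contDiffWithinAt_localVelocity (hV : IsOpen V) (hh : 0 < h)
    (hc : ContMDiffOn 𝓘(ℝ, X × ℝ) I 2 c (V ×ˢ Icc 0 h))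
    {x : M} {z : X × ℝ} (hz : z ∈ V ×ˢ Icc 0 h) (hx : c z ∈ (extChartAt I x).source) :
    ContDiffWithinAt ℝ 1 (fun y : X × ℝ => localVelocity I h (fun s => c (y.1, s)) x y.2)
      (V ×ˢ Icc 0 h) z := by
  have h2 := contDiffWithinAt_extChartAt_comp hc hz hx
  have h3 := (h2.fderivWithin_right (m := 1) (uniqueDiffOn_prod_Icc hV hh)
      (by norm_num) hz).clm_apply (contDiffWithinAt_const (c := ((0 : X), (1 : ℝ))))
  refine ((h2.of_le one_le_two).prodMk h3).congr_of_eventuallyEq_of_mem ?_ hz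
  filter_upwards [eventually_mem_source hc hz hx] with y hy
  exact localVelocity_slice hh hc hy.1 hy.2

variable [I.Boundaryless]

theorem contDiffWithinAt_lagrangian (hV : IsOpen V) (hh : 0 < h)
    (hc : ContMDiffOn 𝓘(ℝ, X × ℝ) I 2 c (V ×ˢ Icc 0 h)) {L : TangentBundle I M → ℝ}
    {z : X × ℝ} (hz : z ∈ V ×ˢ Icc 0 h)
    (hL : ContMDiffAt I.tangent 𝓘(ℝ, ℝ) 1 L (velocity h (fun s => c (z.1, s)) z.2)) :
    ContDiffWithinAt ℝ 1 (fun y : X × ℝ => L (velocity h (fun s => c (y.1, s)) y.2))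
      (V ×ˢ Icc 0 h) z := by
  have hx : c z ∈ (extChartAt I (c z)).source := mem_extChartAt_source _
  have h1 : ContDiffAt ℝ 1 (localLagrangian L (c z))
      (localVelocity I h (fun s => c (z.1, s)) (c z) z.2) :=
    contDiffAt_localLagrangian (v := velocity h (fun s => c (z.1, s)) z.2) hx hL
  refine (h1.comp_contDiffWithinAt z
    (contDiffWithinAt_localVelocity hV hh hc hz hx)).congr_of_eventuallyEq_of_mem ?_ hz
  filter_upwards [eventually_mem_source hc hz hx] with y hy
  exact (localLagrangian_tangentChart L hy.2).symm

/-- The first variation: along a solution, the derivative of `L` in the direction of a variation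
`η` is `d/dt (∂L/∂v · η) - F · η`. -/
theorem hasDerivWithinAt_fibreDeriv_variationField (hV : IsOpen V) (hh : 0 < h)
    (hc : ContMDiffOn 𝓘(ℝ, X × ℝ) I 2 c (V ×ˢ Icc 0 h)) {L : TangentBundle I M → ℝ}
    {F : Force I M} {e : X} (he : e ∈ V)
    (hL : ∀ s ∈ Icc 0 h,
      ContMDiffAt I.tangent 𝓘(ℝ, ℝ) 1 L (velocity h (fun s => c (e, s)) s))
    (hsol : IsSolution L F h fun s => c (e, s)) {t : ℝ} (ht : t ∈ Icc 0 h) (δ : X) :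
    HasDerivWithinAt
      (fun s => fibreDeriv L (velocity h (fun s => c (e, s)) s) (variationField I c e s δ))
      (fderiv ℝ (fun x => L (velocity h (fun s => c (x, s)) t)) e δ
        + F.toModel (velocity h (fun s => c (e, s)) t) (variationField I c e t δ))
      (Icc 0 h) t := by
  set S : Set (X × ℝ) := V ×ˢ Icc 0 h with hS
  have hz : (e, t) ∈ S := ⟨he, ht⟩
  -- The chart is frozen at the point reached at time `t`; there its derivative is the identity, so
  -- covectors at that point equal their coordinate expressions.
  set x : M := c (e, t) with hx_def
  have hx : c (e, t) ∈ (extChartAt I x).source := mem_extChartAt_source _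
  set u : X × ℝ → E := fun y => extChartAt I x (c y) with hu
  have hu2 : ContDiffWithinAt ℝ 2 u S (e, t) := contDiffWithinAt_extChartAt_comp hc hz hx
  have hUD := uniqueDiffOn_prod_Icc (X := X) hV hh
  have hDu : DifferentiableWithinAt ℝ (fderivWithin ℝ u S) S (e, t) :=
    (hu2.fderivWithin_right (m := 1) hUD (by norm_num) hz).differentiableWithinAt one_ne_zero
  set D2 := fderivWithin ℝ (fderivWithin ℝ u S) S (e, t) with hD2
  -- The variation of the velocity is the velocity of the variation.
  have hsymm : D2 (δ, 0) (0, 1) = D2 (0, 1) (δ, 0) :=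
    (hu2.isSymmSndFDerivWithinAt (by simp) hUD (mem_closure_interior_prod_Icc hV hh hz) hz).eq _ _
  set lam := localLagrangian L x with hlam
  set ζ : X × ℝ → E × E := fun y => (u y, fderivWithin ℝ u S y (0, 1)) with hζ
  have hvel : ∀ y ∈ S, c y ∈ (extChartAt I x).source →
      localVelocity I h (fun s => c (y.1, s)) x y.2 = ζ y := fun y hy hy' =>
    localVelocity_slice hh hc hy hy'
  have hζ1 : DifferentiableWithinAt ℝ ζ S (e, t) :=
    (hu2.differentiableWithinAt two_ne_zero).prodMk
      (hDu.clm_apply (differentiableWithinAt_const _))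
  -- the derivative of the Lagrangian in the direction of the variation
  have hlam1 : DifferentiableAt ℝ lam (ζ (e, t)) := by
    have := contDiffAt_localLagrangian (x := x) hx (hL t ht)
    have h2 := hvel _ hz hx
    rw [← h2]
    exact this.differentiableAt one_ne_zero
  have hζδ : HasFDerivAt (fun y => ζ (y, t))
      ((((fderivWithin ℝ u S (e, t)).prod (D2.flip (0, 1)))).comp
        (ContinuousLinearMap.inl ℝ X ℝ)) e := by
    have h2 : HasFDerivWithinAt ζ ((fderivWithin ℝ u S (e, t)).prod (D2.flip (0, 1))) S (e, t) := by
      refine (hu2.differentiableWithinAt two_ne_zero).hasFDerivWithinAt.prodMk ?_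
      have := hDu.hasFDerivWithinAt.clm_apply
        (hasFDerivWithinAt_const ((0 : X), (1 : ℝ)) (e, t) S)
      simpa using this
    have h3 := hasFDerivAt_slice hV he ht hζ1
    rwa [h2.fderivWithin (hUD _ hz)] at h3
  have hA : fderiv ℝ (fun y => L (velocity h (fun s => c (y, s)) t)) e δ
      = dPos lam (ζ (e, t)) (fderivWithin ℝ u S (e, t) (δ, 0))
        + dVel lam (ζ (e, t)) (D2 (δ, 0) (0, 1)) := by
    have h3 := (hlam1.hasFDerivAt.comp e hζδ)
    have h4 : (fun y => L (velocity h (fun s => c (y, s)) t))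
        =ᶠ[𝓝 e] lam ∘ fun y => ζ (y, t) := by
      have hcont : ContinuousAt (fun y => c (y, t)) e :=
        (mdifferentiableAt_slice hV he ht
          ((hc _ hz).mdifferentiableWithinAt two_ne_zero)).continuousAt
      filter_upwards [hV.mem_nhds he, hcont.eventually_mem
        ((isOpen_extChartAt_source x).mem_nhds hx)] with y hy hy'
      have := hvel (y, t) ⟨hy, ht⟩ hy'
      rw [Function.comp_apply, ← this]
      exact (localLagrangian_tangentChart L hy').symm
    rw [h4.fderiv_eq, h3.fderiv]
    simp only [dPos, dVel, ContinuousLinearMap.comp_apply, ContinuousLinearMap.inl_apply,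
      ContinuousLinearMap.inr_apply, ContinuousLinearMap.prod_apply,
      ContinuousLinearMap.flip_apply]
    rw [← map_add]
    simp
  -- the variation field at time `t`
  have hη : ∀ s ∈ Icc 0 h, c (e, s) ∈ (extChartAt I x).source →
      chartDeriv I x (c (e, s)) (variationField I c e s δ)
        = fderivWithin ℝ u S (e, s) (δ, 0) := fun s hs hs' =>
    chartDeriv_variationField hV hc (z := (e, s)) ⟨he, hs⟩ hs' δ
  have hηt : fderivWithin ℝ u S (e, t) (δ, 0) = variationField I c e t δ := by
    rw [← hη t ht hx, ← hx_def, chartDeriv_self]; rfl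
  -- the derivative of the momentum paired with the variation
  have hEL := hsol.eulerLagrange t ht
  have hdu : HasDerivWithinAt (fun s => fderivWithin ℝ u S (e, s) (δ, 0)) (D2 (0, 1) (δ, 0))
      (Icc 0 h) t := by
    have := (hasDerivWithinAt_slice he hDu).clm_apply
      (hasDerivWithinAt_const t (Icc 0 h) ((δ, 0) : X × ℝ))
    simpa using this
  have hB := hEL.clm_apply hdu
  have hvt : localVelocity I h (fun s => c (e, s)) x t = ζ (e, t) := hvel _ hz hx
  rw [hA, hsymm]
  -- Near `t` the curve stays in the frozen chart, where the coordinate pairing is the intrinsic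
  -- one. The chart-dependent equations thus differentiate one globally defined function of time,
  -- which can be integrated over `[0, h]`.
  have hcongr : (fun s => fibreDeriv L (velocity h (fun s => c (e, s)) s)
      (variationField I c e s δ)) =ᶠ[𝓝[Icc 0 h] t] fun s =>
      dVel lam (localVelocity I h (fun s => c (e, s)) x s) (fderivWithin ℝ u S (e, s) (δ, 0)) := by
    have hcont := (mdifferentiableWithinAt_slice he
          ((hc _ hz).mdifferentiableWithinAt two_ne_zero)).continuousWithinAt
    filter_upwards [self_mem_nhdsWithin, hcont.eventually_mem
        ((isOpen_extChartAt_source x).mem_nhds hx)] with s hs hs'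
    rw [← hη s hs hs']
    exact (dVel_localLagrangian (v := velocity h (fun s => c (e, s)) s) hs' (hL s hs) _).symm
  refine (hB.congr_of_eventuallyEq_of_mem hcongr ht).congr_deriv ?_
  have hvt' : localVelocity I h (fun s => c (e, s)) (c (e, t)) t = ζ (e, t) := hvt
  simp only [hvt', hηt]
  rw [add_apply]
  ring

end Variation

theorem one_le_infty : (1 : WithTop ℕ∞) ≤ ∞ := by simp

/-! ### The generalized potential to first order at the identities. -/

section Potential

variable {E : Type*} [NormedAddCommGroup E] [NormedSpace ℝ E]
  {H : Type*} [TopologicalSpace H] {I : ModelWithCorners ℝ E H}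
  {M : Type*} [TopologicalSpace M] [ChartedSpace H M] [IsManifold I ∞ M]
  {F : Force I M} {R : TangentBundle I M → M} {τ : ∀ q : M, M → TangentSpace I q}
  {Z : Set (TangentBundle I M)} {U : Set (M × M)}

theorem IsLocalInverse.map_diag (hτ : IsLocalInverse R τ Z U) (hR : IsRetraction R) (q : M) :
    (q, q) ∈ U ∧ τ q q = 0 := by
  have := hτ.left_inv _ (hτ.zero_mem q)
  rwa [hR.map_zero] at this

/-- The two velocities may differ: this kills the fibre derivative of the potential over the
diagonal as well as its value. -/
theorem potential_eq_zero (hτ : IsLocalInverse R τ Z U) (hR : IsRetraction R) (q : M)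
    (a b : TangentSpace I q) : potential F τ ⟨q, a⟩ ⟨q, b⟩ = 0 := by
  simp [potential, (hτ.map_diag hR q).2]

/-- The pairing `⟨F(V_Q), τ(Q, q)⟩`. -/
noncomputable def forcePairing (F : Force I M) (τ : ∀ q : M, M → TangentSpace I q)
    (p : TangentBundle I M × TangentBundle I M) : ℝ :=
  F p.2 (τ p.2.proj p.1.proj)

/-- F and τ are smooth only as maps into bundles, so their pairing is differentiated as a bundle map
applied to a section along `p ↦ p.2.proj`; outside `U` nothing is known of τ. -/
theorem contMDiffAt_forcePairing (hF : IsSmoothForce F) (hτ : IsLocalInverse R τ Z U)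
    {p : TangentBundle I M × TangentBundle I M} (hp : (p.2.proj, p.1.proj) ∈ U) :
    ContMDiffAt (I.tangent.prod I.tangent) 𝓘(ℝ, ℝ) 1 (forcePairing F τ) p := by
  have h1 : ContMDiffAt (I.tangent.prod I.tangent) (I.prod 𝓘(ℝ, E →L[ℝ] ℝ)) 1
      (fun p : TangentBundle I M × TangentBundle I M =>
      (TotalSpace.mk' (E →L[ℝ] ℝ) p.2.proj (F p.2) :
        TotalSpace (E →L[ℝ] ℝ) (fun q : M => TangentSpace I q →L[ℝ] Bundle.Trivial M ℝ q))) p :=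
    ContMDiffAt.comp p ((hF p.2).of_le one_le_infty) contMDiffAt_snd
  have hproj : ∀ v : TangentBundle I M, ContMDiffAt I.tangent I 1 (fun v => v.proj) v :=
    fun v => contMDiffAt_proj (TangentSpace I)
  have h2 : ContMDiffAt (I.tangent.prod I.tangent) (I.prod 𝓘(ℝ, E)) 1
      (fun p : TangentBundle I M × TangentBundle I M =>
        (TotalSpace.mk' E p.2.proj (τ p.2.proj p.1.proj) : TangentBundle I M)) p := by
    refine ContMDiffAt.comp (g := fun x : M × M => (⟨x.1, τ x.1 x.2⟩ : TangentBundle I M))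
      (f := fun p : TangentBundle I M × TangentBundle I M => (p.2.proj, p.1.proj)) p
      ((hτ.contMDiffOn.contMDiffAt (hτ.isOpen_target.mem_nhds hp)).of_le one_le_infty) ?_
    exact ((hproj _).comp p contMDiffAt_snd).prodMk ((hproj _).comp p contMDiffAt_fst)
  have h3 := ContMDiffAt.clm_bundle_apply (E₂ := Bundle.Trivial M ℝ) (F₂ := ℝ) h1 h2
  have h4 := (contMDiffAt_totalSpace.1 h3).2
  exact h4

theorem contMDiffAt_potential (hF : IsSmoothForce F) (hτ : IsLocalInverse R τ Z U)
    {p : TangentBundle I M × TangentBundle I M} (hp : (p.1.proj, p.2.proj) ∈ U)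
    (hp' : (p.2.proj, p.1.proj) ∈ U) :
    ContMDiffAt (I.tangent.prod I.tangent) 𝓘(ℝ, ℝ) 1 (fun p => potential F τ p.1 p.2) p := by
  have h1 := contMDiffAt_forcePairing hF hτ hp'
  have h2 : ContMDiffAt (I.tangent.prod I.tangent) 𝓘(ℝ, ℝ) 1
      (fun p : TangentBundle I M × TangentBundle I M => forcePairing F τ (p.2, p.1)) p :=
    ContMDiffAt.comp (g := forcePairing F τ) p
      (contMDiffAt_forcePairing (p := (p.2, p.1)) hF hτ hp)
      (contMDiffAt_snd.prodMk contMDiffAt_fst)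
  have h3 : ContDiff ℝ 1 fun r : ℝ × ℝ => 1 / 2 * r.1 - 1 / 2 * r.2 := by fun_prop
  exact h3.contMDiff.contMDiffAt.comp p (h1.prodMk_space h2)

variable [I.Boundaryless]

theorem contMDiffAt_fibre (q : M) (u : E) :
    ContMDiffAt 𝓘(ℝ, E) I.tangent 1 (fun u : E => (⟨q, u⟩ : TangentBundle I M)) u := by
  have hq : q ∈ (extChartAt I q).source := mem_extChartAt_source q
  have h1 : (fun u : E => (⟨q, u⟩ : TangentBundle I M))
      = (tangentChart I q).symm ∘ fun u : E => (extChartAt I q q, u) := by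
    funext u
    have := tangentChart_symm_apply hq u
    rw [chartDeriv_self] at this
    exact this.symm
  rw [h1]
  exact ContMDiffAt.comp u (contMDiffAt_tangentChart_symm ((extChartAt I q).map_source hq))
    (contDiffAt_const.prodMk contDiffAt_id).contMDiffAt

/-- The map `Q ↦ τ(x, Q)` is tangent to the identity at `x`. -/
theorem hasFDerivAt_localInverse (hR : IsRetraction R) (hτ : IsLocalInverse R τ Z U) (x : M) :
    HasFDerivAt (fun y : E => (τ x ((extChartAt I x).symm y) : E))
      (ContinuousLinearMap.id ℝ E) (extChartAt I x x) := by
  set T : E → E := fun y => (τ x ((extChartAt I x).symm y) : E) with hT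
  have hx : x ∈ (extChartAt I x).source := mem_extChartAt_source x
  have hsymm : ContMDiffAt 𝓘(ℝ, E) I 1 (extChartAt I x).symm (extChartAt I x x) :=
    (contMDiffOn_extChartAt_symm x).contMDiffAt (extChartAt_target_mem_nhds x)
  have hpair : ContMDiffAt 𝓘(ℝ, E) (I.prod I) 1
      (fun y : E => (x, (extChartAt I x).symm y)) (extChartAt I x x) :=
    contMDiffAt_const.prodMk hsymm
  have hxx : (x, (extChartAt I x).symm (extChartAt I x x)) ∈ U := by
    rw [(extChartAt I x).left_inv hx]; exact (hτ.map_diag hR x).1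
  have hTdiff : DifferentiableAt ℝ T (extChartAt I x x) := by
    have h1 : ContMDiffAt 𝓘(ℝ, E) I.tangent 1
        (fun y : E => (⟨x, T y⟩ : TangentBundle I M)) (extChartAt I x x) :=
      ContMDiffAt.comp (g := fun p : M × M => (⟨p.1, τ p.1 p.2⟩ : TangentBundle I M))
        (f := fun y : E => (x, (extChartAt I x).symm y)) _
        ((hτ.contMDiffOn.contMDiffAt (hτ.isOpen_target.mem_nhds hxx)).of_le one_le_infty) hpair
    have h2 : ContMDiffAt 𝓘(ℝ, E) 𝓘(ℝ, E × E) 1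
        (fun y : E => tangentChart I x (⟨x, T y⟩ : TangentBundle I M)) (extChartAt I x x) :=
      ContMDiffAt.comp _ (contMDiffAt_tangentChart
        (v := (⟨x, T (extChartAt I x x)⟩ : TangentBundle I M)) hx) h1
    have h3 := (contMDiffAt_iff_contDiffAt.1 h2).differentiableAt one_ne_zero
    have h4 : (fun y : E => tangentChart I x (⟨x, T y⟩ : TangentBundle I M))
        = fun y => (extChartAt I x x, T y) := by
      funext y
      exact tangentChart_self (⟨x, T y⟩ : TangentBundle I M)
    rw [h4] at h3
    exact h3.snd
  -- `ρ` is R_x in the chart. It is a left inverse of `T` near the base point and has derivative the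
  -- identity at 0, so the chain rule forces the derivative of `T` to be the identity.
  set ρ : E → E := fun u => extChartAt I x (R (⟨x, u⟩ : TangentBundle I M)) with hρ
  have hT0 : T (extChartAt I x x) = 0 := by
    simp only [hT]
    rw [(extChartAt I x).left_inv hx]; exact (hτ.map_diag hR x).2
  have hρ' : HasFDerivAt ρ (ContinuousLinearMap.id ℝ E) (T (extChartAt I x x)) := by
    rw [hT0]
    have h1 : MDifferentiableAt 𝓘(ℝ, E) I (fun u : E => R (⟨x, u⟩ : TangentBundle I M)) 0 :=
      (ContMDiffAt.comp (0 : E) ((hR.contMDiff _).of_le one_le_infty)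
        (contMDiffAt_fibre x 0)).mdifferentiableAt one_ne_zero
    have h0 : R (⟨x, (0 : E)⟩ : TangentBundle I M) ∈ (chartAt H x).source := by
      have := hR.map_zero x
      exact (congrArg (· ∈ (chartAt H x).source) this).mpr (mem_chart_source H x)
    have hφ := mdifferentiableAt_extChartAt (I := I) h0
    have h2 : DifferentiableAt ℝ ρ 0 := (MDifferentiableAt.comp (0 : E) hφ h1).differentiableAt
    have h3 := mfderiv_comp (0 : E) hφ h1
    rw [mfderiv_eq_fderiv] at h3
    have h4 : fderiv ℝ ρ 0 = ContinuousLinearMap.id ℝ E := by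
      ext w
      refine (DFunLike.congr_fun h3 w).trans ?_
      have h5 : chartDeriv I x (R (⟨x, (0 : E)⟩ : TangentBundle I M))
          = ContinuousLinearMap.id ℝ E := by
        rw [← chartDeriv_self (I := I) x]
        exact congrArg (chartDeriv I x) (hR.map_zero x)
      refine (DFunLike.congr_fun h5 _).trans ?_
      exact hR.mfderiv_zero x w
    rw [← h4]
    exact h2.hasFDerivAt
  have hcomp := hρ'.comp _ hTdiff.hasFDerivAt
  have hid : ρ ∘ T =ᶠ[𝓝 (extChartAt I x x)] id := by
    filter_upwards [hpair.continuousAt.eventually_mem (hτ.isOpen_target.mem_nhds hxx),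
      extChartAt_target_mem_nhds (I := I) x] with y hy hy'
    have := (hτ.right_inv _ hy).2
    exact (congrArg (extChartAt I x) this).trans ((extChartAt I x).right_inv hy')
  have h6 := (hcomp.congr_of_eventuallyEq hid.symm).unique (hasFDerivAt_id _)
  have h7 : fderiv ℝ T (extChartAt I x x) = ContinuousLinearMap.id ℝ E := by
    rw [← h6]; ext; simp
  rw [← h7]
  exact hTdiff.hasFDerivAt

/-- The pairing is zero on the diagonal, so its derivative kills (ξ, ξ) and is determined by (ξ, 0).
In that direction the covector F(v) and the base point of τ are fixed, and only the derivative of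
τ(x, ·) remains. -/
theorem hasFDerivAt_localForcePairing (hF : IsSmoothForce F) (hR : IsRetraction R)
    (hτ : IsLocalInverse R τ Z U) (v : TangentBundle I M) :
    HasFDerivAt (fun p : (E × E) × (E × E) => forcePairing F τ
        ((tangentChart I v.proj).symm p.1, (tangentChart I v.proj).symm p.2))
      ((F.toModel v).comp ((ContinuousLinearMap.fst ℝ E E).comp
        (ContinuousLinearMap.fst ℝ (E × E) (E × E) - ContinuousLinearMap.snd ℝ (E × E) (E × E))))
      (tangentChart I v.proj v, tangentChart I v.proj v) := by
  set x := v.proj with hx_def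
  have hx : x ∈ (extChartAt I x).source := mem_extChartAt_source x
  set ζ := tangentChart I x v with hζ
  have hζ1 : ζ = (extChartAt I x x, v.2) := tangentChart_self v
  have hζt : ζ.1 ∈ (extChartAt I x).target := by
    rw [hζ1]; exact (extChartAt I x).map_source hx
  have hζs : (tangentChart I x).symm ζ = v :=
    (tangentChart I x).left_inv (mem_tangentChart_source.2 hx)
  set f : (E × E) × (E × E) → ℝ := fun p => forcePairing F τ
    ((tangentChart I x).symm p.1, (tangentChart I x).symm p.2) with hf
  have hfd : DifferentiableAt ℝ f (ζ, ζ) := by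
    have h1 : ContMDiffAt 𝓘(ℝ, (E × E) × (E × E)) (I.tangent.prod I.tangent) 1
        (fun p : (E × E) × (E × E) =>
          ((tangentChart I x).symm p.1, (tangentChart I x).symm p.2)) (ζ, ζ) :=
      (ContMDiffAt.comp (ζ, ζ) (contMDiffAt_tangentChart_symm hζt)
          contDiffAt_fst.contMDiffAt).prodMk
        (ContMDiffAt.comp (ζ, ζ) (contMDiffAt_tangentChart_symm hζt)
          contDiffAt_snd.contMDiffAt)
    have h2 : ContMDiffAt 𝓘(ℝ, (E × E) × (E × E)) 𝓘(ℝ, ℝ) 1 f (ζ, ζ) := by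
      refine ContMDiffAt.comp (g := forcePairing F τ) (ζ, ζ)
        (contMDiffAt_forcePairing hF hτ ?_) h1
      simp only [hζs]
      exact (hτ.map_diag hR _).1
    exact (contMDiffAt_iff_contDiffAt.1 h2).differentiableAt one_ne_zero
  have hdiag : ∀ ξ : E × E, fderiv ℝ f (ζ, ζ) (ξ, ξ) = 0 := by
    intro ξ
    have h1 : HasFDerivAt (fun z : E × E => (z, z))
        ((ContinuousLinearMap.id ℝ (E × E)).prod (ContinuousLinearMap.id ℝ (E × E))) ζ :=
      (hasFDerivAt_id ζ).prodMk (hasFDerivAt_id ζ)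
    have h2 := HasFDerivAt.comp (g := f) (f := fun z : E × E => (z, z)) ζ hfd.hasFDerivAt h1
    have h3 : f ∘ (fun z : E × E => (z, z)) = fun _ => (0 : ℝ) := by
      funext z
      simp only [hf, Function.comp_apply, forcePairing]
      rw [(hτ.map_diag hR _).2, map_zero]
    rw [h3] at h2
    have h4 := h2.unique (hasFDerivAt_const _ _)
    simpa using DFunLike.congr_fun h4 ξ
  have hfst : ∀ ξ : E × E, fderiv ℝ f (ζ, ζ) (ξ, 0) = F.toModel v ξ.1 := by
    intro ξ
    have h1 := HasFDerivAt.comp (g := f) (f := fun z : E × E => (z, ζ)) ζ hfd.hasFDerivAt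
      (hasFDerivAt_prodMk_left ζ ζ)
    have h2 : f ∘ (fun z : E × E => (z, ζ)) =ᶠ[𝓝 ζ]
        fun z => F.toModel v (τ x ((extChartAt I x).symm z.1)) := by
      have : ∀ᶠ z : E × E in 𝓝 ζ, z.1 ∈ (extChartAt I x).target :=
        continuous_fst.continuousAt.eventually_mem ((isOpen_extChartAt_target x).mem_nhds hζt)
      filter_upwards [this] with z hz
      change forcePairing F τ ((tangentChart I x).symm z, (tangentChart I x).symm ζ) = _
      rw [hζs, forcePairing, tangentChart_symm_proj hz]
      rfl
    have h3 : HasFDerivAt (fun z : E × E => F.toModel v (τ x ((extChartAt I x).symm z.1)))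
        ((F.toModel v).comp ((ContinuousLinearMap.id ℝ E).comp (ContinuousLinearMap.fst ℝ E E)))
        ζ := by
      let T : E → E := fun y => τ x ((extChartAt I x).symm y)
      have h4 : HasFDerivAt T (ContinuousLinearMap.id ℝ E) (extChartAt I x x) :=
        hasFDerivAt_localInverse hR hτ x
      have h5 : HasFDerivAt T (ContinuousLinearMap.id ℝ E) ζ.1 := by rw [hζ1]; exact h4
      exact (F.toModel v).hasFDerivAt.comp ζ (h5.comp ζ hasFDerivAt_fst)
    have h6 := (h1.congr_of_eventuallyEq h2.symm).unique h3
    simpa using DFunLike.congr_fun h6 ξ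
  have hD : fderiv ℝ f (ζ, ζ) = (F.toModel v).comp ((ContinuousLinearMap.fst ℝ E E).comp
      (ContinuousLinearMap.fst ℝ (E × E) (E × E)
        - ContinuousLinearMap.snd ℝ (E × E) (E × E))) := by
    refine ContinuousLinearMap.ext fun p => ?_
    have h1 : p = (p.1 - p.2, 0) + (p.2, p.2) := by ext <;> simp
    conv_lhs => rw [h1, map_add, hdiag, hfst]
    simp
  rw [← hD]
  exact hfd.hasFDerivAt

/-- The derivative of the generalized potential at the identities. -/
theorem hasFDerivAt_localPotential (hF : IsSmoothForce F) (hR : IsRetraction R)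
    (hτ : IsLocalInverse R τ Z U) (v : TangentBundle I M) :
    HasFDerivAt (fun p : (E × E) × (E × E) => potential F τ
        ((tangentChart I v.proj).symm p.1) ((tangentChart I v.proj).symm p.2))
      ((F.toModel v).comp ((ContinuousLinearMap.fst ℝ E E).comp
        (ContinuousLinearMap.fst ℝ (E × E) (E × E) - ContinuousLinearMap.snd ℝ (E × E) (E × E))))
      (tangentChart I v.proj v, tangentChart I v.proj v) := by
  have h1 := hasFDerivAt_localForcePairing hF hR hτ v
  have h2 := HasFDerivAt.comp (f := fun p : (E × E) × (E × E) => (p.2, p.1))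
    (tangentChart I v.proj v, tangentChart I v.proj v) h1
    (hasFDerivAt_snd.prodMk hasFDerivAt_fst)
  -- Exchanging the arguments reverses the sign of the derivative, so the two halves add up.
  refine ((h1.const_mul (1 / 2 : ℝ)).sub (h2.const_mul (1 / 2 : ℝ))).congr_fderiv ?_
  ext p <;> simp <;> ring

theorem contDiffAt_localPotential (hF : IsSmoothForce F) (hR : IsRetraction R)
    (hτ : IsLocalInverse R τ Z U) (x : M) {z z' : E × E}
    (hz : z.1 ∈ (extChartAt I x).target) (hzz' : z.1 = z'.1) :
    ContDiffAt ℝ 1 (fun p : (E × E) × (E × E) => potential F τ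
        ((tangentChart I x).symm p.1) ((tangentChart I x).symm p.2)) (z, z') := by
  have hz' : z'.1 ∈ (extChartAt I x).target := hzz' ▸ hz
  have h1 : ContMDiffAt 𝓘(ℝ, (E × E) × (E × E)) (I.tangent.prod I.tangent) 1
      (fun p : (E × E) × (E × E) =>
        ((tangentChart I x).symm p.1, (tangentChart I x).symm p.2)) (z, z') :=
    (ContMDiffAt.comp (z, z') (contMDiffAt_tangentChart_symm hz)
        contDiffAt_fst.contMDiffAt).prodMk
      (ContMDiffAt.comp (z, z') (contMDiffAt_tangentChart_symm hz')
        contDiffAt_snd.contMDiffAt)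
  rw [← contMDiffAt_iff_contDiffAt]
  refine ContMDiffAt.comp (g := fun p : TangentBundle I M × TangentBundle I M =>
    potential F τ p.1 p.2) (z, z') (contMDiffAt_potential hF hτ ?_ ?_) h1
  · simp only [tangentChart_symm_proj hz, tangentChart_symm_proj hz', hzz']
    exact (hτ.map_diag hR _).1
  · simp only [tangentChart_symm_proj hz, tangentChart_symm_proj hz', hzz']
    exact (hτ.map_diag hR _).1

end Potential

/-! ### The potential along two families of curves. -/

section PotentialVariation

variable {E : Type*} [NormedAddCommGroup E] [NormedSpace ℝ E]
  {H : Type*} [TopologicalSpace H] {I : ModelWithCorners ℝ E H} [I.Boundaryless]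
  {M : Type*} [TopologicalSpace M] [ChartedSpace H M] [IsManifold I ∞ M]
  {F : Force I M} {R : TangentBundle I M → M} {τ : ∀ q : M, M → TangentSpace I q}
  {Z : Set (TangentBundle I M)} {U : Set (M × M)}
  {X : Type*} [NormedAddCommGroup X] [NormedSpace ℝ X] {V : Set X} {h : ℝ}
  {c c' : X × ℝ → M}

omit [I.Boundaryless] in
theorem potential_velocity_eventuallyEq
    (hc : ContMDiffOn 𝓘(ℝ, X × ℝ) I 2 c (V ×ˢ Icc 0 h))
    (hc' : ContMDiffOn 𝓘(ℝ, X × ℝ) I 2 c' (V ×ˢ Icc 0 h))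
    {z : X × ℝ} (hz : z ∈ V ×ˢ Icc 0 h) (hcc' : c z = c' z) :
    (fun y : X × ℝ => potential F τ (velocity h (fun s => c (y.1, s)) y.2)
        (velocity h (fun s => c' (y.1, s)) y.2)) =ᶠ[𝓝[V ×ˢ Icc 0 h] z]
      fun y => potential F τ
        ((tangentChart I (c z)).symm (localVelocity I h (fun s => c (y.1, s)) (c z) y.2))
        ((tangentChart I (c z)).symm (localVelocity I h (fun s => c' (y.1, s)) (c z) y.2)) := by
  have hx : c z ∈ (extChartAt I (c z)).source := mem_extChartAt_source _
  have hx' : c' z ∈ (extChartAt I (c z)).source := by rwa [← hcc']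
  filter_upwards [eventually_mem_source hc hz hx, eventually_mem_source hc' hz hx']
    with y hy hy'
  have h1 := (tangentChart I (c z)).left_inv (x := velocity h (fun s => c (y.1, s)) y.2)
    (mem_tangentChart_source.2 hy.2)
  have h2 := (tangentChart I (c z)).left_inv (x := velocity h (fun s => c' (y.1, s)) y.2)
    (mem_tangentChart_source.2 hy'.2)
  rw [localVelocity, localVelocity, h1, h2]

theorem contDiffWithinAt_potential (hF : IsSmoothForce F) (hR : IsRetraction R)
    (hτ : IsLocalInverse R τ Z U) (hV : IsOpen V) (hh : 0 < h)
    (hc : ContMDiffOn 𝓘(ℝ, X × ℝ) I 2 c (V ×ˢ Icc 0 h))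
    (hc' : ContMDiffOn 𝓘(ℝ, X × ℝ) I 2 c' (V ×ˢ Icc 0 h))
    {z : X × ℝ} (hz : z ∈ V ×ˢ Icc 0 h) (hcc' : c z = c' z) :
    ContDiffWithinAt ℝ 1 (fun y : X × ℝ => potential F τ (velocity h (fun s => c (y.1, s)) y.2)
        (velocity h (fun s => c' (y.1, s)) y.2)) (V ×ˢ Icc 0 h) z := by
  have hx : c z ∈ (extChartAt I (c z)).source := mem_extChartAt_source _
  have hx' : c' z ∈ (extChartAt I (c z)).source := by rwa [← hcc']
  have h1 := contDiffWithinAt_localVelocity hV hh hc hz hx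
  have h2 := contDiffWithinAt_localVelocity hV hh hc' hz hx'
  have e1 := localVelocity_slice hh hc hz hx
  have e2 := localVelocity_slice hh hc' hz hx'
  refine ContDiffWithinAt.congr_of_eventuallyEq_of_mem ?_
    (potential_velocity_eventuallyEq hc hc' hz hcc') hz
  refine ContDiffAt.comp_contDiffWithinAt z
    (contDiffAt_localPotential hF hR hτ (c z) ?_ ?_) (h1.prodMk h2)
  · rw [e1]; exact (extChartAt I (c z)).map_source hx
  · rw [e1, e2, hcc']

-- Only the base component of the derivative is identified, since the differential of the potential
-- at the identities ignores variations of velocity.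
omit [I.Boundaryless] in
theorem hasFDerivAt_localVelocity_fst (hV : IsOpen V) (hh : 0 < h)
    (hc : ContMDiffOn 𝓘(ℝ, X × ℝ) I 2 c (V ×ˢ Icc 0 h)) {e : X} {t : ℝ} (he : e ∈ V)
    (ht : t ∈ Icc 0 h) {x : M} (hx : c (e, t) = x) :
    ∃ D : X →L[ℝ] E × E,
      HasFDerivAt (fun y => localVelocity I h (fun s => c (y, s)) x t) D e ∧
      ∀ δ, (D δ).1 = variationField I c e t δ := by
  have hz : (e, t) ∈ V ×ˢ Icc 0 h := ⟨he, ht⟩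
  have hx' : c (e, t) ∈ (extChartAt I x).source := hx ▸ mem_extChartAt_source _
  have h1 := hasFDerivAt_slice hV he ht
    ((contDiffWithinAt_localVelocity hV hh hc hz hx').differentiableWithinAt one_ne_zero)
  refine ⟨_, h1, fun δ => ?_⟩
  have h2 := (contDiffWithinAt_extChartAt_comp hc hz hx').differentiableWithinAt two_ne_zero
  have h3 := hasFDerivAt_slice hV he ht h2
  have h4 : (fun y => (localVelocity I h (fun s => c (y, s)) x t).1)
      =ᶠ[𝓝 e] fun y => extChartAt I x (c (y, t)) := by
    have hcont : ContinuousAt (fun y => c (y, t)) e :=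
      (mdifferentiableAt_slice hV he ht
        ((hc _ hz).mdifferentiableWithinAt two_ne_zero)).continuousAt
    filter_upwards [hV.mem_nhds he, hcont.eventually_mem
      ((isOpen_extChartAt_source x).mem_nhds hx')] with y hy hy'
    rw [localVelocity_slice hh hc (z := (y, t)) ⟨hy, ht⟩ hy']
  have h5 := (h3.congr_of_eventuallyEq h4).unique h1.fst
  have h6 := chartDeriv_variationField hV hc hz hx' δ
  have h7 : chartDeriv I x (c (e, t)) = ContinuousLinearMap.id ℝ E := by
    rw [hx, chartDeriv_self]
  rw [h7] at h6
  refine Eq.trans ?_ h6.symm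
  simpa using (DFunLike.congr_fun h5 δ).symm

/-- The derivative of the potential along two families of curves which agree to first order. -/
theorem fderiv_potential (hF : IsSmoothForce F) (hR : IsRetraction R)
    (hτ : IsLocalInverse R τ Z U) (hV : IsOpen V) (hh : 0 < h)
    (hc : ContMDiffOn 𝓘(ℝ, X × ℝ) I 2 c (V ×ˢ Icc 0 h))
    (hc' : ContMDiffOn 𝓘(ℝ, X × ℝ) I 2 c' (V ×ˢ Icc 0 h)) {e : X} {t : ℝ} (he : e ∈ V)
    (ht : t ∈ Icc 0 h)
    (hv : velocity (I := I) h (fun s => c (e, s)) t = velocity h (fun s => c' (e, s)) t) (δ : X) :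
    fderiv ℝ (fun y => potential F τ (velocity h (fun s => c (y, s)) t)
        (velocity h (fun s => c' (y, s)) t)) e δ
      = F.toModel (velocity h (fun s => c (e, s)) t)
        (variationField I c e t δ - variationField I c' e t δ) := by
  have hz : (e, t) ∈ V ×ˢ Icc 0 h := ⟨he, ht⟩
  have hcc' : c (e, t) = c' (e, t) := congrArg TotalSpace.proj hv
  obtain ⟨D, hD, hDδ⟩ := hasFDerivAt_localVelocity_fst hV hh hc he ht rfl
  obtain ⟨D', hD', hDδ'⟩ := hasFDerivAt_localVelocity_fst hV hh hc' he ht hcc'.symm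
  have h1 := hasFDerivAt_localPotential hF hR hτ (velocity h (fun s => c (e, s)) t)
  have h2 : HasFDerivAt (fun p : (E × E) × (E × E) => potential F τ
        ((tangentChart I (c (e, t))).symm p.1) ((tangentChart I (c (e, t))).symm p.2))
      ((F.toModel (velocity h (fun s => c (e, s)) t)).comp ((ContinuousLinearMap.fst ℝ E E).comp
        (ContinuousLinearMap.fst ℝ (E × E) (E × E) - ContinuousLinearMap.snd ℝ (E × E) (E × E))))
      (localVelocity I h (fun s => c (e, s)) (c (e, t)) t,
        localVelocity I h (fun s => c' (e, s)) (c (e, t)) t) := by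
    have : localVelocity I h (fun s => c' (e, s)) (c (e, t)) t
        = localVelocity I h (fun s => c (e, s)) (c (e, t)) t := by
      rw [localVelocity, localVelocity, hv]
    rw [this]
    exact h1
  have h3 := h2.comp e (hD.prodMk hD')
  have h4 := potential_velocity_eventuallyEq (F := F) (τ := τ) hc hc' hz hcc'
  have h5 : Tendsto (fun y : X => (y, t)) (𝓝 e) (𝓝[V ×ˢ Icc 0 h] (e, t)) :=
    tendsto_nhdsWithin_iff.2 ⟨(Continuous.prodMk_left t).continuousAt, by
      filter_upwards [hV.mem_nhds he] with y hy using ⟨hy, ht⟩⟩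
  have h6 := h3.congr_of_eventuallyEq (h5.eventually h4)
  rw [h6.fderiv, ← hDδ, ← hDδ']
  simp

end PotentialVariation

/-! ### The duplicated Lagrangian at the identities. -/

section Duplicated

variable {E : Type*} [NormedAddCommGroup E] [NormedSpace ℝ E]
  {H : Type*} [TopologicalSpace H] {I : ModelWithCorners ℝ E H}
  {M : Type*} [TopologicalSpace M] [ChartedSpace H M]

theorem velocity_prodMk {h : ℝ} (hh : 0 < h) {c c' : ℝ → M} {t : ℝ} (ht : t ∈ Icc 0 h)
    (hc : MDifferentiableWithinAt 𝓘(ℝ, ℝ) I c (Icc 0 h) t)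
    (hc' : MDifferentiableWithinAt 𝓘(ℝ, ℝ) I c' (Icc 0 h) t) :
    velocity (I := I.prod I) h (fun s => (c s, c' s)) t
      = (equivTangentBundleProd I M I M).symm (velocity h c t, velocity h c' t) := by
  have hu : UniqueMDiffWithinAt 𝓘(ℝ, ℝ) (Icc 0 h) t :=
    (uniqueDiffOn_Icc hh t ht).uniqueMDiffWithinAt
  have h1 := (hc.hasMFDerivWithinAt.prodMk hc'.hasMFDerivWithinAt).mfderivWithin hu
  rw [velocity, h1]
  rfl

variable [IsManifold I ∞ M]

theorem chartDeriv_prod {x x' q q' : M} (hq : q ∈ (extChartAt I x).source)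
    (hq' : q' ∈ (extChartAt I x').source) :
    chartDeriv (I.prod I) (x, x') (q, q') = (chartDeriv I x q).prodMap (chartDeriv I x' q') := by
  rw [extChartAt_source] at hq hq'
  have h1 := (mdifferentiableAt_extChartAt (I := I) hq).hasMFDerivAt.comp (q, q')
    (hasMFDerivAt_fst (I := I) (I' := I) (x := (q, q')))
  have h2 := (mdifferentiableAt_extChartAt (I := I) hq').hasMFDerivAt.comp (q, q')
    (hasMFDerivAt_snd (I := I) (I' := I) (x := (q, q')))
  have h3 : (extChartAt (I.prod I) (x, x') : M × M → E × E)
      = fun p => (extChartAt I x p.1, extChartAt I x' p.2) := by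
    rw [extChartAt_prod]; rfl
  rw [chartDeriv, h3]
  have h4 : HasMFDerivAt (I.prod I) 𝓘(ℝ, E × E)
      (fun p : M × M => (extChartAt I x p.1, extChartAt I x' p.2)) (q, q')
      ((chartDeriv I x q).prodMap (chartDeriv I x' q')) :=
    ⟨h1.1.prodMk h2.1, h1.2.prodMk h2.2⟩
  exact h4.mfderiv

theorem chartDeriv_surjective {x q : M} (hq : q ∈ (extChartAt I x).source) :
    Function.Surjective (chartDeriv I x q) :=
  (isInvertible_mfderiv_extChartAt (I := I) hq).surjective

/-- The chart of T(M × M) groups coordinates as ((q, Q), (v, V)), that of TM × TM as ((q, v), (Q,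
V)); this is the reshuffling between them. -/
theorem tangentChart_prod {x : M} {v v' : TangentBundle I M}
    (hv : v.proj ∈ (extChartAt I x).source) (hv' : v'.proj ∈ (extChartAt I x).source) :
    tangentChart (I.prod I) (x, x) ((equivTangentBundleProd I M I M).symm (v, v'))
      = (((tangentChart I x v).1, (tangentChart I x v').1),
          ((tangentChart I x v).2, (tangentChart I x v').2)) := by
  have h0 : (v.proj, v'.proj) ∈ (extChartAt (I.prod I) (x, x)).source := by
    rw [extChartAt_prod]; exact ⟨hv, hv'⟩
  have h1 := tangentChart_apply (I := I.prod I) (x := (x, x))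
    (v := (equivTangentBundleProd I M I M).symm (v, v')) h0
  rw [h1, tangentChart_apply hv, tangentChart_apply hv']
  have h2 := chartDeriv_prod hv hv'
  refine Prod.ext (by rw [extChartAt_prod]; rfl) ?_
  exact DFunLike.congr_fun h2 (v.2, v'.2)

theorem tangentChart_prod_symm {x : M} {z z' : E × E} (hz : z.1 ∈ (extChartAt I x).target)
    (hz' : z'.1 ∈ (extChartAt I x).target) :
    (tangentChart (I.prod I) (x, x)).symm ((z.1, z'.1), (z.2, z'.2))
      = (equivTangentBundleProd I M I M).symm
        ((tangentChart I x).symm z, (tangentChart I x).symm z') := by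
  have hz2 := mem_tangentChart_target.2 hz
  have hz2' := mem_tangentChart_target.2 hz'
  have h1 := mem_tangentChart_source.1 ((tangentChart I x).map_target hz2)
  have h1' := mem_tangentChart_source.1 ((tangentChart I x).map_target hz2')
  have h2 := tangentChart_prod h1 h1'
  rw [(tangentChart I x).right_inv hz2, (tangentChart I x).right_inv hz2'] at h2
  rw [← h2]
  refine (tangentChart (I.prod I) (x, x)).left_inv (mem_tangentChart_source.2 ?_)
  rw [extChartAt_prod]; exact ⟨h1, h1'⟩

variable {F : Force I M} {R : TangentBundle I M → M} {τ : ∀ q : M, M → TangentSpace I q}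
  {Z : Set (TangentBundle I M)} {U : Set (M × M)} {L : TangentBundle I M → ℝ}

theorem localLagrangian_dupLagrangian {x : M} {z z' : E × E}
    (hz : z.1 ∈ (extChartAt I x).target) (hz' : z'.1 ∈ (extChartAt I x).target) :
    localLagrangian (I := I.prod I) (dupLagrangian L F τ) (x, x) ((z.1, z'.1), (z.2, z'.2))
      = localLagrangian L x z' - localLagrangian L x z
        - potential F τ ((tangentChart I x).symm z) ((tangentChart I x).symm z') := by
  rw [localLagrangian]
  refine (congrArg (dupLagrangian L F τ) (tangentChart_prod_symm hz hz')).trans ?_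
  rfl

theorem contMDiffAt_dupLagrangian (hL : ContMDiff I.tangent 𝓘(ℝ, ℝ) ∞ L)
    (hF : IsSmoothForce F) (hτ : IsLocalInverse R τ Z U)
    {w : TangentBundle (I.prod I) (M × M)} (hw : (w.proj.1, w.proj.2) ∈ U)
    (hw' : (w.proj.2, w.proj.1) ∈ U) :
    ContMDiffAt (I.prod I).tangent 𝓘(ℝ, ℝ) 1 (dupLagrangian L F τ) w := by
  have h0 : ContMDiffAt (I.prod I).tangent (I.tangent.prod I.tangent) 1
      (equivTangentBundleProd I M I M) w := contMDiff_equivTangentBundleProd w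
  have hL1 : ContMDiff I.tangent 𝓘(ℝ, ℝ) 1 L := hL.of_le one_le_infty
  have h1 : ContMDiffAt (I.prod I).tangent 𝓘(ℝ, ℝ) 1
      (fun w => L (equivTangentBundleProd I M I M w).1) w :=
    ContMDiffAt.comp w (hL1 _) (contMDiffAt_fst.comp w h0)
  have h2 : ContMDiffAt (I.prod I).tangent 𝓘(ℝ, ℝ) 1
      (fun w => L (equivTangentBundleProd I M I M w).2) w :=
    ContMDiffAt.comp w (hL1 _) (contMDiffAt_snd.comp w h0)
  have h3 : ContMDiffAt (I.prod I).tangent 𝓘(ℝ, ℝ) 1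
      (fun w => potential F τ (equivTangentBundleProd I M I M w).1
        (equivTangentBundleProd I M I M w).2) w :=
    ContMDiffAt.comp (g := fun p : TangentBundle I M × TangentBundle I M =>
      potential F τ p.1 p.2) w
      (contMDiffAt_potential (p := equivTangentBundleProd I M I M w) hF hτ hw hw') h0
  exact (h2.sub h1).sub h3

variable [I.Boundaryless]

/-- Over (q, q) the potential vanishes on the whole fibre, so only the two copies of L contribute.
-/
theorem fibreDeriv_dupLagrangian (hL : ContMDiff I.tangent 𝓘(ℝ, ℝ) ∞ L)
    (hR : IsRetraction R) (hτ : IsLocalInverse R τ Z U) (v : TangentBundle I M) (a : E × E) :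
    fibreDeriv (dupLagrangian L F τ) (tangentIdentity v) a
      = fibreDeriv L v a.2 - fibreDeriv L v a.1 := by
  let q := v.proj
  let u₀ : E := v.2
  let l : E → ℝ := fun u => L (⟨q, u⟩ : TangentBundle I M)
  have hl : HasFDerivAt l (fibreDeriv L v) u₀ := by
    have h1 : ContMDiffAt 𝓘(ℝ, E) 𝓘(ℝ, ℝ) 1 l u₀ :=
      ContMDiffAt.comp u₀ ((hL _).of_le one_le_infty) (contMDiffAt_fibre q u₀)
    exact ((contMDiffAt_iff_contDiffAt.1 h1).differentiableAt one_ne_zero).hasFDerivAt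
  have h1 : (fun u : E × E => dupLagrangian L F τ (⟨(q, q), u⟩ : TangentBundle (I.prod I) (M × M)))
      = fun u => l u.2 - l u.1 := by
    funext u
    have := potential_eq_zero (F := F) hτ hR q u.1 u.2
    change L ⟨q, u.2⟩ - L ⟨q, u.1⟩ - potential F τ ⟨q, u.1⟩ ⟨q, u.2⟩ = _
    rw [this, sub_zero]
  have h2 : HasFDerivAt (fun u : E × E => l u.2 - l u.1)
      ((fibreDeriv L v).comp (ContinuousLinearMap.snd ℝ E E)
        - (fibreDeriv L v).comp (ContinuousLinearMap.fst ℝ E E)) (u₀, u₀) :=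
    (HasFDerivAt.comp (g := l) (u₀, u₀) hl hasFDerivAt_snd).sub
      (HasFDerivAt.comp (g := l) (u₀, u₀) hl hasFDerivAt_fst)
  have h3 : fibreDeriv (dupLagrangian L F τ) (tangentIdentity v)
      = fderiv ℝ (fun u : E × E => l u.2 - l u.1) (u₀, u₀) := by
    rw [← h1]; rfl
  rw [h3, h2.fderiv]
  simp

/-- The chart point `x` need not be the base point of `v`, because the momentum is differentiated in
time in a fixed chart. The identity moves from intrinsic fibre derivatives to coordinates because
the chart derivative is surjective. -/
theorem dVel_dupLagrangian (hL : ContMDiff I.tangent 𝓘(ℝ, ℝ) ∞ L) (hF : IsSmoothForce F)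
    (hR : IsRetraction R) (hτ : IsLocalInverse R τ Z U) {x : M} {v : TangentBundle I M}
    (hv : v.proj ∈ (extChartAt I x).source) :
    dVel (localLagrangian (I := I.prod I) (dupLagrangian L F τ) (x, x))
        (tangentChart (I.prod I) (x, x) (tangentIdentity v))
      = (dVel (localLagrangian L x) (tangentChart I x v)).comp
          (ContinuousLinearMap.snd ℝ E E - ContinuousLinearMap.fst ℝ E E) := by
  refine ContinuousLinearMap.ext fun b => ?_
  obtain ⟨a₁, ha₁⟩ := chartDeriv_surjective hv b.1
  obtain ⟨a₂, ha₂⟩ := chartDeriv_surjective hv b.2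
  have h0 : (v.proj, v.proj) ∈ (extChartAt (I.prod I) (x, x)).source := by
    rw [extChartAt_prod]; exact ⟨hv, hv⟩
  have hU := (hτ.map_diag hR v.proj).1
  have h1 := dVel_localLagrangian (I := I.prod I) (x := (x, x)) (v := tangentIdentity v) h0
    (contMDiffAt_dupLagrangian (L := L) hL hF hτ hU hU) (a₁, a₂)
  have h2 : chartDeriv (I.prod I) (x, x) (tangentIdentity v).proj (a₁, a₂) = b := by
    refine (DFunLike.congr_fun (chartDeriv_prod hv hv) (a₁, a₂)).trans ?_
    exact Prod.ext ha₁ ha₂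
  rw [h2, fibreDeriv_dupLagrangian hL hR hτ] at h1
  have hL1 := (hL v).of_le one_le_infty
  rw [h1, ← dVel_localLagrangian hv hL1, ← dVel_localLagrangian hv hL1, ha₁, ha₂]
  simp

/-- Here the force enters: minus the differential of the potential is F(v)·(δQ − δq), with the same
sign pattern as L(V) − L(v). -/
theorem dPos_dupLagrangian (hL : ContMDiff I.tangent 𝓘(ℝ, ℝ) ∞ L) (hF : IsSmoothForce F)
    (hR : IsRetraction R) (hτ : IsLocalInverse R τ Z U) (v : TangentBundle I M) :
    dPos (localLagrangian (I := I.prod I) (dupLagrangian L F τ) (v.proj, v.proj))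
        (tangentChart (I.prod I) (v.proj, v.proj) (tangentIdentity v))
      = (dPos (localLagrangian L v.proj) (tangentChart I v.proj v) + F.toModel v).comp
          (ContinuousLinearMap.snd ℝ E E - ContinuousLinearMap.fst ℝ E E) := by
  set x := v.proj with hx_def
  have hx : v.proj ∈ (extChartAt I x).source := mem_extChartAt_source _
  set ζ := tangentChart I x v with hζ
  have hζt : ζ.1 ∈ (extChartAt I x).target := by
    rw [hζ, tangentChart_apply hx]; exact (extChartAt I x).map_source hx
  have hw : tangentChart (I.prod I) (x, x) (tangentIdentity v)
      = ((ζ.1, ζ.1), (ζ.2, ζ.2)) := tangentChart_prod hx hx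
  let P : (E × E) × (E × E) →L[ℝ] E × E :=
    ((ContinuousLinearMap.fst ℝ E E).comp (ContinuousLinearMap.fst ℝ (E × E) (E × E))).prod
      ((ContinuousLinearMap.fst ℝ E E).comp (ContinuousLinearMap.snd ℝ (E × E) (E × E)))
  let P' : (E × E) × (E × E) →L[ℝ] E × E :=
    ((ContinuousLinearMap.snd ℝ E E).comp (ContinuousLinearMap.fst ℝ (E × E) (E × E))).prod
      ((ContinuousLinearMap.snd ℝ E E).comp (ContinuousLinearMap.snd ℝ (E × E) (E × E)))
  set w₀ : (E × E) × (E × E) := ((ζ.1, ζ.1), (ζ.2, ζ.2)) with hw₀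
  set l := localLagrangian L x with hl_def
  let k : (E × E) × (E × E) → ℝ := fun p => potential F τ
    ((tangentChart I x).symm p.1) ((tangentChart I x).symm p.2)
  have hl : HasFDerivAt l (fderiv ℝ l ζ) ζ :=
    ((contDiffAt_localLagrangian hx ((hL v).of_le one_le_infty)).differentiableAt
      one_ne_zero).hasFDerivAt
  have hk : HasFDerivAt k _ (P w₀, P' w₀) := hasFDerivAt_localPotential hF hR hτ v
  have h1 : HasFDerivAt (fun w => l (P' w) - l (P w) - k (P w, P' w)) _ w₀ :=
    ((HasFDerivAt.comp (g := l) w₀ hl P'.hasFDerivAt).sub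
      (HasFDerivAt.comp (g := l) w₀ hl P.hasFDerivAt)).sub
      (HasFDerivAt.comp (g := k) w₀ hk (P.hasFDerivAt.prodMk P'.hasFDerivAt))
  have h2 : localLagrangian (I := I.prod I) (dupLagrangian L F τ) (x, x)
      =ᶠ[𝓝 w₀] fun w => l (P' w) - l (P w) - k (P w, P' w) := by
    have ht := (isOpen_extChartAt_target (I := I) x).mem_nhds hζt
    have e1 : ∀ᶠ w : (E × E) × (E × E) in 𝓝 w₀, w.1.1 ∈ (extChartAt I x).target :=
      (continuous_fst.comp continuous_fst).continuousAt.eventually_mem ht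
    have e2 : ∀ᶠ w : (E × E) × (E × E) in 𝓝 w₀, w.1.2 ∈ (extChartAt I x).target :=
      (continuous_snd.comp continuous_fst).continuousAt.eventually_mem ht
    filter_upwards [e1, e2] with w hw1 hw2
    exact localLagrangian_dupLagrangian (z := (w.1.1, w.2.1)) (z' := (w.1.2, w.2.2)) hw1 hw2
  rw [hw, dPos, (h1.congr_of_eventuallyEq h2).fderiv]
  refine ContinuousLinearMap.ext fun b => ?_
  simp only [P, P', dPos, ContinuousLinearMap.comp_apply, sub_apply, add_apply,
    ContinuousLinearMap.prod_apply, ContinuousLinearMap.inl_apply, ContinuousLinearMap.coe_fst',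
    ContinuousLinearMap.coe_snd', map_sub]
  change fderiv ℝ l ζ (b.2, 0) - fderiv ℝ l ζ (b.1, 0) - _ = _
  ring

/-- Two copies of a solution of the forced system solve the duplicated system. -/
theorem IsSolution.duplicate (hL : ContMDiff I.tangent 𝓘(ℝ, ℝ) ∞ L) (hF : IsSmoothForce F)
    (hR : IsRetraction R) (hτ : IsLocalInverse R τ Z U) {h : ℝ} (hh : 0 < h) {c : ℝ → M}
    (hc : IsSolution L F h c) :
    IsSolution (I := I.prod I) (dupLagrangian L F τ) noForce h fun t => (c t, c t) := by
  have hd : ∀ s ∈ Icc 0 h, MDifferentiableWithinAt 𝓘(ℝ, ℝ) I c (Icc 0 h) s := fun s hs =>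
    (hc.contMDiffOn s hs).mdifferentiableWithinAt two_ne_zero
  have hvel : ∀ s ∈ Icc 0 h, velocity (I := I.prod I) h (fun t => (c t, c t)) s
      = tangentIdentity (velocity h c s) := fun s hs =>
    velocity_prodMk hh hs (hd s hs) (hd s hs)
  refine ⟨hc.contMDiffOn.prodMk hc.contMDiffOn, fun t ht => ?_⟩
  have hEL := hc.eulerLagrange t ht
  -- Composing the forced equation with the constant map (δq, δQ) ↦ δQ − δq turns both sides into
  -- those of the free duplicated equation.
  have hB := hEL.clm_comp (hasDerivWithinAt_const t (Icc 0 h)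
    (ContinuousLinearMap.snd ℝ E E - ContinuousLinearMap.fst ℝ E E))
  have hcongr : (fun s => dVel (localLagrangian (I := I.prod I) (dupLagrangian L F τ) (c t, c t))
        (localVelocity (I.prod I) h (fun t => (c t, c t)) (c t, c t) s)) =ᶠ[𝓝[Icc 0 h] t]
      fun s => (dVel (localLagrangian L (c t)) (localVelocity I h c (c t) s)).comp
        (ContinuousLinearMap.snd ℝ E E - ContinuousLinearMap.fst ℝ E E) := by
    filter_upwards [self_mem_nhdsWithin, (hd t ht).continuousWithinAt.eventually_mem
      ((isOpen_extChartAt_source (I := I) (c t)).mem_nhds (mem_extChartAt_source _))] with s hs hs'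
    rw [localVelocity, hvel s hs]
    exact dVel_dupLagrangian hL hF hR hτ (v := velocity h c s) hs'
  refine (hB.congr_of_eventuallyEq_of_mem hcongr ht).congr_deriv ?_
  have h1 : dPos (localLagrangian (I := I.prod I) (dupLagrangian L F τ) (c t, c t))
        (localVelocity (I.prod I) h (fun t => (c t, c t)) (c t, c t) t)
      = (dPos (localLagrangian L (c t)) (localVelocity I h c (c t) t)
          + F.toModel (velocity h c t)).comp
          (ContinuousLinearMap.snd ℝ E E - ContinuousLinearMap.fst ℝ E E) := by
    rw [localVelocity, hvel t ht]
    exact dPos_dupLagrangian hL hF hR hτ (velocity h c t)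
  have h2 : ∀ w, Force.toModel (I := I.prod I) (M := M × M) noForce w = 0 := fun _ => rfl
  rw [h1, h2]
  simp

end Duplicated

/-! ### Families of curves with parameters in a manifold. -/

section Parameters

variable {E : Type*} [NormedAddCommGroup E] [NormedSpace ℝ E]
  {H : Type*} [TopologicalSpace H] {I : ModelWithCorners ℝ E H}
  {M : Type*} [TopologicalSpace M] [ChartedSpace H M]
  {X : Type*} [NormedAddCommGroup X] [NormedSpace ℝ X]
  {K : Type*} [TopologicalSpace K] {J : ModelWithCorners ℝ X K}
  {N : Type*} [TopologicalSpace N] [ChartedSpace K N]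
  {γ : N → ℝ → M} {W : Set N} {h : ℝ} {p : N}

/-- The variation at time `t` of a family of curves with respect to its parameter, read in the
model spaces. -/
noncomputable def parameterVariation (J : ModelWithCorners ℝ X K) (I : ModelWithCorners ℝ E H)
    (γ : N → ℝ → M) (p : N) (t : ℝ) : X →L[ℝ] E :=
  mfderiv J I (fun x => γ x t) p

/-- A family of curves read in the preferred chart of its parameter space at `p`. -/
noncomputable def chartFamily (J : ModelWithCorners ℝ X K) (γ : N → ℝ → M) (p : N) (z : X × ℝ) : M :=
  γ ((extChartAt J p).symm z.1) z.2

theorem tangentBundle_mk_congr {q q' : M} (hq : q = q') (a : E) :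
    (⟨q, a⟩ : TangentBundle I M) = ⟨q', a⟩ := by
  subst hq; rfl

theorem velocity_congr {c c' : ℝ → M} (hcc' : EqOn c c' (Icc 0 h)) {t : ℝ} (ht : t ∈ Icc 0 h) :
    velocity (I := I) h c t = velocity h c' t := by
  have h1 : (mfderivWithin 𝓘(ℝ, ℝ) I c (Icc 0 h) t : ℝ →L[ℝ] E)
      = mfderivWithin 𝓘(ℝ, ℝ) I c' (Icc 0 h) t := mfderivWithin_congr hcc' (hcc' ht)
  refine (tangentBundle_mk_congr (I := I) (hcc' ht) _).trans ?_
  exact congrArg (fun A : ℝ →L[ℝ] E => (⟨c' t, A 1⟩ : TangentBundle I M)) h1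

variable [IsManifold J ∞ N] [J.Boundaryless]

-- The preferred chart at `p` has derivative the identity at `p`, so a derivative computed in it is
-- already the manifold derivative.
omit [J.Boundaryless] in
theorem hasMFDerivAt_of_chart {G : N → ℝ} {D : X →L[ℝ] ℝ}
    (hG : HasFDerivAt (fun e => G ((extChartAt J p).symm e)) D (extChartAt J p p)) :
    HasMFDerivAt J 𝓘(ℝ, ℝ) G p D := by
  have h1 := hG.hasMFDerivAt.comp p
    (mdifferentiableAt_extChartAt (I := J) (mem_chart_source K p)).hasMFDerivAt
  rw [mfderiv_extChartAt_self] at h1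
  refine HasMFDerivAt.congr_of_eventuallyEq h1 ?_
  filter_upwards [extChartAt_source_mem_nhds (I := J) p] with x hx
  exact congrArg G ((extChartAt J p).left_inv hx).symm

omit [J.Boundaryless] in
theorem variationField_chartFamily {t : ℝ}
    (hc : MDifferentiableAt 𝓘(ℝ, X) I (fun e => chartFamily J γ p (e, t)) (extChartAt J p p)) :
    variationField I (chartFamily J γ p) (extChartAt J p p) t = parameterVariation J I γ p t := by
  have h1 := mfderiv_comp p hc (mdifferentiableAt_extChartAt (I := J) (mem_chart_source K p))
  rw [mfderiv_extChartAt_self] at h1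
  have h2 : (fun x => γ x t) =ᶠ[𝓝 p] (fun e => chartFamily J γ p (e, t)) ∘ extChartAt J p := by
    filter_upwards [extChartAt_source_mem_nhds (I := J) p] with x hx
    exact congrArg (γ · t) ((extChartAt J p).left_inv hx).symm
  have h3 : parameterVariation J I γ p t
      = mfderiv J I ((fun e => chartFamily J γ p (e, t)) ∘ extChartAt J p) p := h2.mfderiv_eq
  rw [h3]
  exact h1.symm

/-- The domain of a family of curves, read in a chart of its parameter space. -/
def chartDomain (J : ModelWithCorners ℝ X K) (W : Set N) (p : N) : Set X :=
  (extChartAt J p).target ∩ (extChartAt J p).symm ⁻¹' W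

omit [IsManifold J ∞ N] in
theorem isOpen_chartDomain (hW : IsOpen W) : IsOpen (chartDomain J W p) :=
  (continuousOn_extChartAt_symm p).isOpen_inter_preimage (isOpen_extChartAt_target p) hW

omit [IsManifold J ∞ N] [J.Boundaryless] in
theorem mem_chartDomain (hp : p ∈ W) : extChartAt J p p ∈ chartDomain J W p :=
  ⟨mem_extChartAt_target p, by rwa [mem_preimage, extChartAt_to_inv]⟩

omit [J.Boundaryless] in
theorem contMDiffOn_chartFamily
    (hγ : ContMDiffOn (J.prod 𝓘(ℝ, ℝ)) I 2 (fun z : N × ℝ => γ z.1 z.2) (W ×ˢ Icc 0 h)) :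
    ContMDiffOn 𝓘(ℝ, X × ℝ) I 2 (chartFamily J γ p) (chartDomain J W p ×ˢ Icc 0 h) := by
  have h1 : ContMDiffOn 𝓘(ℝ, X × ℝ) J 2 (fun z : X × ℝ => (extChartAt J p).symm z.1)
      (chartDomain J W p ×ˢ Icc 0 h) :=
    (contMDiffOn_extChartAt_symm p).comp contDiff_fst.contMDiff.contMDiffOn
      fun z hz => hz.1.1
  exact hγ.comp (h1.prodMk contDiff_snd.contMDiff.contMDiffOn) fun z hz => ⟨hz.1.2, hz.2⟩

omit [TopologicalSpace M] [IsManifold J ∞ N] [J.Boundaryless] in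
theorem chartFamily_self (t : ℝ) : chartFamily J γ p (extChartAt J p p, t) = γ p t := by
  rw [chartFamily, extChartAt_to_inv]

theorem variationField_eq_parameterVariation (hW : IsOpen W) (hp : p ∈ W)
    (hγ : ContMDiffOn (J.prod 𝓘(ℝ, ℝ)) I 2 (fun z : N × ℝ => γ z.1 z.2) (W ×ˢ Icc 0 h))
    {t : ℝ} (ht : t ∈ Icc 0 h) :
    variationField I (chartFamily J γ p) (extChartAt J p p) t = parameterVariation J I γ p t :=
  variationField_chartFamily (mdifferentiableAt_slice (isOpen_chartDomain hW) (mem_chartDomain hp)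
    ht ((contMDiffOn_chartFamily hγ _ ⟨mem_chartDomain hp, ht⟩).mdifferentiableWithinAt
      two_ne_zero))

omit [IsManifold J ∞ N] [J.Boundaryless] in
theorem mdifferentiableAt_parameter (hW : IsOpen W) (hp : p ∈ W)
    (hγ : ContMDiffOn (J.prod 𝓘(ℝ, ℝ)) I 2 (fun z : N × ℝ => γ z.1 z.2) (W ×ˢ Icc 0 h))
    {t : ℝ} (ht : t ∈ Icc 0 h) : MDifferentiableAt J I (fun x => γ x t) p := by
  have h1 : ContMDiffOn J I 2 (fun x => γ x t) W :=
    hγ.comp (contMDiffOn_id.prodMk contMDiffOn_const) fun x hx => ⟨hx, ht⟩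
  exact (h1.contMDiffAt (hW.mem_nhds hp)).mdifferentiableAt two_ne_zero

/-- Differentiation under the integral sign with respect to a parameter in a manifold. -/
theorem hasMFDerivAt_intervalIntegral (hW : IsOpen W) (hp : p ∈ W) (hh : 0 < h)
    {g : N → ℝ → ℝ}
    (hg : ∀ t ∈ Icc 0 h, ContDiffWithinAt ℝ 1
      (fun z : X × ℝ => g ((extChartAt J p).symm z.1) z.2)
      (chartDomain J W p ×ˢ Icc 0 h) (extChartAt J p p, t))
    {D : X →L[ℝ] ℝ} (hD : D = ∫ t in (0 : ℝ)..h,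
      fderiv ℝ (fun e => g ((extChartAt J p).symm e) t) (extChartAt J p p)) :
    HasMFDerivAt J 𝓘(ℝ, ℝ) (fun x => ∫ t in (0 : ℝ)..h, g x t) p D :=
  hasMFDerivAt_of_chart
    (hD ▸ hasFDerivAt_intervalIntegral (isOpen_chartDomain hW) hh (mem_chartDomain hp) hg)

end Parameters

/-! ### Derivatives of the potential integral and of the action. -/

section Families

variable {E : Type*} [NormedAddCommGroup E] [NormedSpace ℝ E]
  {H : Type*} [TopologicalSpace H] {I : ModelWithCorners ℝ E H} [I.Boundaryless]
  {M : Type*} [TopologicalSpace M] [ChartedSpace H M] [IsManifold I ∞ M]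
  {X : Type*} [NormedAddCommGroup X] [NormedSpace ℝ X]
  {K : Type*} [TopologicalSpace K] {J : ModelWithCorners ℝ X K} [J.Boundaryless]
  {N : Type*} [TopologicalSpace N] [ChartedSpace K N] [IsManifold J ∞ N]
  {h : ℝ}

/-- The derivative of the integral of the generalized potential along two families of curves, at a
parameter where the two curves coincide. -/
theorem hasMFDerivAt_integral_potential {F : Force I M} {R : TangentBundle I M → M}
    {τ : ∀ q : M, M → TangentSpace I q} {Z : Set (TangentBundle I M)} {U : Set (M × M)}
    (hF : IsSmoothForce F) (hR : IsRetraction R) (hτ : IsLocalInverse R τ Z U) (hh : 0 < h)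
    {W : Set N} {γ γ' : N → ℝ → M} {p : N} (hW : IsOpen W) (hp : p ∈ W)
    (hγ : ContMDiffOn (J.prod 𝓘(ℝ, ℝ)) I 2 (fun z : N × ℝ => γ z.1 z.2) (W ×ˢ Icc 0 h))
    (hγ' : ContMDiffOn (J.prod 𝓘(ℝ, ℝ)) I 2 (fun z : N × ℝ => γ' z.1 z.2) (W ×ˢ Icc 0 h))
    (hγγ' : EqOn (γ p) (γ' p) (Icc 0 h)) :
    MDifferentiableAt J 𝓘(ℝ, ℝ) (fun x => ∫ t in (0 : ℝ)..h,
        potential F τ (velocity h (γ x) t) (velocity h (γ' x) t)) p ∧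
      (∀ Δ : X, IntervalIntegrable (fun t => F.toModel (velocity h (γ p) t)
        (parameterVariation J I γ p t Δ - parameterVariation J I γ' p t Δ))
        MeasureTheory.volume 0 h) ∧
      ∀ Δ : X, differential J (fun x => ∫ t in (0 : ℝ)..h,
        potential F τ (velocity h (γ x) t) (velocity h (γ' x) t)) p Δ
        = ∫ t in (0 : ℝ)..h, F.toModel (velocity h (γ p) t)
          (parameterVariation J I γ p t Δ - parameterVariation J I γ' p t Δ) := by
  set e := extChartAt J p p with he_def
  have he : e ∈ chartDomain J W p := mem_chartDomain hp
  have hV := isOpen_chartDomain (J := J) (p := p) hW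
  have hc := contMDiffOn_chartFamily (p := p) hγ
  have hc' := contMDiffOn_chartFamily (p := p) hγ'
  have hcp : (fun s => chartFamily J γ p (e, s)) = γ p := funext chartFamily_self
  have hcp' : (fun s => chartFamily J γ' p (e, s)) = γ' p := funext chartFamily_self
  have hg : ∀ t ∈ Icc 0 h, ContDiffWithinAt ℝ 1
      (fun z : X × ℝ => potential F τ (velocity h (γ ((extChartAt J p).symm z.1)) z.2)
        (velocity h (γ' ((extChartAt J p).symm z.1)) z.2))
      (chartDomain J W p ×ˢ Icc 0 h) (e, t) := fun t ht =>
    contDiffWithinAt_potential hF hR hτ hV hh hc hc' (z := (e, t)) ⟨he, ht⟩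
      (by rw [chartFamily_self, chartFamily_self]; exact hγγ' ht)
  have hD : ∀ t ∈ Icc 0 h, ∀ Δ, fderiv ℝ
      (fun x => potential F τ (velocity h (γ ((extChartAt J p).symm x)) t)
        (velocity h (γ' ((extChartAt J p).symm x)) t)) e Δ
      = F.toModel (velocity h (γ p) t)
          (parameterVariation J I γ p t Δ - parameterVariation J I γ' p t Δ) := by
    intro t ht Δ
    have h1 := fderiv_potential hF hR hτ hV hh hc hc' he ht
      (by rw [hcp, hcp']; exact velocity_congr hγγ' ht) Δ
    rw [hcp, variationField_eq_parameterVariation hW hp hγ ht,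
      variationField_eq_parameterVariation hW hp hγ' ht] at h1
    exact h1
  have hmain := hasMFDerivAt_intervalIntegral (J := J)
    (g := fun x t => potential F τ (velocity h (γ x) t) (velocity h (γ' x) t)) hW hp hh hg rfl
  have hI := uIcc_of_le hh.le
  refine ⟨hmain.mdifferentiableAt, fun Δ => ?_, fun Δ => ?_⟩
  · refine ContinuousOn.intervalIntegrable ?_
    rw [hI]
    exact ((continuousOn_fderiv_slice hV hh he hg).clm_apply continuousOn_const).congr
      fun t ht => (hD t ht Δ).symm
  · refine (DFunLike.congr_fun hmain.mfderiv Δ).trans ?_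
    refine (intervalIntegral_fderiv_slice_apply hV hh he hg Δ).trans ?_
    exact intervalIntegral.integral_congr fun t ht => hD t (hI ▸ ht) Δ

/-- The derivative of the action along a family of solutions: the boundary terms of the first
variation, minus the work of the force. -/
theorem hasMFDerivAt_action {L : TangentBundle I M → ℝ} {F : Force I M} (hh : 0 < h)
    {W : Set N} {γ : N → ℝ → M} {p : N} (hW : IsOpen W) (hp : p ∈ W)
    (hγ : ContMDiffOn (J.prod 𝓘(ℝ, ℝ)) I 2 (fun z : N × ℝ => γ z.1 z.2) (W ×ˢ Icc 0 h))
    (hL : ∀ t ∈ Icc 0 h, ContMDiffAt I.tangent 𝓘(ℝ, ℝ) 1 L (velocity h (γ p) t))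
    (hsol : IsSolution L F h (γ p))
    (hint : ∀ δ : X, IntervalIntegrable (fun t => F.toModel (velocity h (γ p) t)
      (parameterVariation J I γ p t δ)) MeasureTheory.volume 0 h) :
    MDifferentiableAt J 𝓘(ℝ, ℝ) (fun x => ∫ t in (0 : ℝ)..h, L (velocity h (γ x) t)) p ∧
      ∀ δ : X, differential J (fun x => ∫ t in (0 : ℝ)..h, L (velocity h (γ x) t)) p δ
        = fibreDeriv L (velocity h (γ p) h) (parameterVariation J I γ p h δ)
          - fibreDeriv L (velocity h (γ p) 0) (parameterVariation J I γ p 0 δ)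
          - ∫ t in (0 : ℝ)..h, F.toModel (velocity h (γ p) t)
            (parameterVariation J I γ p t δ) := by
  set e := extChartAt J p p with he_def
  have he : e ∈ chartDomain J W p := mem_chartDomain hp
  have hV := isOpen_chartDomain (J := J) (p := p) hW
  have hc := contMDiffOn_chartFamily (p := p) hγ
  have hcp : (fun s => chartFamily J γ p (e, s)) = γ p := funext chartFamily_self
  have hvar : ∀ t ∈ Icc 0 h, variationField I (chartFamily J γ p) e t
      = parameterVariation J I γ p t := fun t ht =>
    variationField_eq_parameterVariation hW hp hγ ht
  have hg : ∀ t ∈ Icc 0 h, ContDiffWithinAt ℝ 1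
      (fun z : X × ℝ => L (velocity h (γ ((extChartAt J p).symm z.1)) z.2))
      (chartDomain J W p ×ˢ Icc 0 h) (e, t) := fun t ht =>
    contDiffWithinAt_lagrangian hV hh hc (z := (e, t)) ⟨he, ht⟩
      (by have := hL t ht; rwa [← hcp] at this)
  have hmain := hasMFDerivAt_intervalIntegral (J := J)
    (g := fun x t => L (velocity h (γ x) t)) hW hp hh hg rfl
  have hI := uIcc_of_le hh.le
  refine ⟨hmain.mdifferentiableAt, fun δ => ?_⟩
  refine (DFunLike.congr_fun hmain.mfderiv δ).trans ?_
  refine (intervalIntegral_fderiv_slice_apply hV hh he hg δ).trans ?_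
  have hB : ∀ t ∈ Icc 0 h, HasDerivWithinAt
      (fun s => fibreDeriv L (velocity h (γ p) s)
        (variationField I (chartFamily J γ p) e s δ))
      (fderiv ℝ (fun x => L (velocity h (γ ((extChartAt J p).symm x)) t)) e δ
        + F.toModel (velocity h (γ p) t) (parameterVariation J I γ p t δ)) (Icc 0 h) t := by
    intro t ht
    have h1 := hasDerivWithinAt_fibreDeriv_variationField hV hh hc he
      (by rw [hcp]; exact hL) (by rw [hcp]; exact hsol) ht δ
    rw [hcp, hvar t ht] at h1
    exact h1
  have hint1 : IntervalIntegrable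
      (fun t => fderiv ℝ (fun x => L (velocity h (γ ((extChartAt J p).symm x)) t)) e δ)
      MeasureTheory.volume 0 h := by
    refine ContinuousOn.intervalIntegrable ?_
    rw [hI]
    exact (continuousOn_fderiv_slice hV hh he hg).clm_apply continuousOn_const
  -- The fundamental theorem needs two-sided derivatives only inside the interval; at the ends
  -- continuity suffices.
  have hFTC := intervalIntegral.integral_eq_sub_of_hasDerivAt_of_le hh.le
    (fun t ht => (hB t ht).continuousWithinAt)
    (fun t ht => (hB t (Ioo_subset_Icc_self ht)).hasDerivAt (Icc_mem_nhds ht.1 ht.2))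
    (hint1.add (hint δ))
  rw [intervalIntegral.integral_add hint1 (hint δ), hvar h (right_mem_Icc.2 hh.le),
    hvar 0 (left_mem_Icc.2 hh.le)] at hFTC
  rw [← hFTC]
  ring

end Families

/-! ### Exact discrete objects and their differentials. -/

section BoundaryValue

variable {E : Type*} [NormedAddCommGroup E] [NormedSpace ℝ E]
  {H : Type*} [TopologicalSpace H] {I : ModelWithCorners ℝ E H}
  {M : Type*} [TopologicalSpace M] [ChartedSpace H M]

theorem D₁_eq_differential {G : M × M → ℝ} {p : M × M}
    (hG : MDifferentiableAt (I.prod I) 𝓘(ℝ, ℝ) G p) (a : E) :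
    D₁ I G p a = differential (I.prod I) G p (a, (0 : E)) := by
  have h1 : HasMFDerivAt I (I.prod I) (fun x : M => (x, p.2)) p.1
      (ContinuousLinearMap.inl ℝ E E) :=
    (hasMFDerivAt_id p.1).prodMk (hasMFDerivAt_const p.2 p.1)
  exact DFunLike.congr_fun (HasMFDerivAt.comp p.1 hG.hasMFDerivAt h1).mfderiv a

theorem D₂_eq_differential {G : M × M → ℝ} {p : M × M}
    (hG : MDifferentiableAt (I.prod I) 𝓘(ℝ, ℝ) G p) (b : E) :
    D₂ I G p b = differential (I.prod I) G p ((0 : E), b) := by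
  have h1 : HasMFDerivAt I (I.prod I) (fun x : M => (p.1, x)) p.2
      (ContinuousLinearMap.inr ℝ E E) :=
    (hasMFDerivAt_const p.1 p.2).prodMk (hasMFDerivAt_id p.2)
  exact DFunLike.congr_fun (HasMFDerivAt.comp p.2 hG.hasMFDerivAt h1).mfderiv b

variable {L : TangentBundle I M → ℝ} {F : Force I M} {h : ℝ} {γ : M × M → ℝ → M} {p : M × M}

theorem exactForceMinus_eq (hh : 0 < h)
    (hγ : ∀ t ∈ Icc 0 h, MDifferentiableAt (I.prod I) I (fun x => γ x t) p) (a : E) :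
    exactForceMinus F h γ p a = ∫ t in (0 : ℝ)..h, F.toModel (velocity h (γ p) t)
      (parameterVariation (I.prod I) I γ p t (a, 0)) := by
  refine intervalIntegral.integral_congr fun t ht => ?_
  rw [uIcc_of_le hh.le] at ht
  have h1 : HasMFDerivAt I (I.prod I) (fun x : M => (x, p.2)) p.1
      (ContinuousLinearMap.inl ℝ E E) :=
    (hasMFDerivAt_id p.1).prodMk (hasMFDerivAt_const p.2 p.1)
  exact congrArg (F.toModel (velocity h (γ p) t))
    (DFunLike.congr_fun (HasMFDerivAt.comp p.1 (hγ t ht).hasMFDerivAt h1).mfderiv a)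

theorem exactForcePlus_eq (hh : 0 < h)
    (hγ : ∀ t ∈ Icc 0 h, MDifferentiableAt (I.prod I) I (fun x => γ x t) p) (b : E) :
    exactForcePlus F h γ p b = ∫ t in (0 : ℝ)..h, F.toModel (velocity h (γ p) t)
      (parameterVariation (I.prod I) I γ p t (0, b)) := by
  refine intervalIntegral.integral_congr fun t ht => ?_
  rw [uIcc_of_le hh.le] at ht
  have h1 : HasMFDerivAt I (I.prod I) (fun x : M => (p.1, x)) p.2
      (ContinuousLinearMap.inr ℝ E E) :=
    (hasMFDerivAt_const p.1 p.2).prodMk (hasMFDerivAt_id p.2)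
  exact congrArg (F.toModel (velocity h (γ p) t))
    (DFunLike.congr_fun (HasMFDerivAt.comp p.2 (hγ t ht).hasMFDerivAt h1).mfderiv b)

theorem parameterVariation_firstCopy {t : ℝ}
    (hγ : MDifferentiableAt (I.prod I) I (fun x => γ x t) p) (Δ : (E × E) × (E × E)) :
    parameterVariation ((I.prod I).prod (I.prod I)) I
        (fun P : (M × M) × (M × M) => γ (P.1.1, P.2.1)) (discreteIdentity p) t Δ
      = parameterVariation (I.prod I) I γ p t (Δ.1.1, Δ.2.1) := by
  have h1 := hasMFDerivAt_fst (I := I.prod I) (I' := I.prod I) (x := discreteIdentity p)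
  have h2 := hasMFDerivAt_snd (I := I.prod I) (I' := I.prod I) (x := discreteIdentity p)
  have h3 := (hasMFDerivAt_fst (I := I) (I' := I) (x := (p.1, p.1))).comp (discreteIdentity p) h1
  have h4 := (hasMFDerivAt_fst (I := I) (I' := I) (x := (p.2, p.2))).comp (discreteIdentity p) h2
  have h5 := HasMFDerivAt.comp (g := fun x : M × M => γ x t) (discreteIdentity p)
    hγ.hasMFDerivAt (h3.prodMk h4)
  exact DFunLike.congr_fun h5.mfderiv Δ

theorem parameterVariation_secondCopy {t : ℝ}
    (hγ : MDifferentiableAt (I.prod I) I (fun x => γ x t) p) (Δ : (E × E) × (E × E)) :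
    parameterVariation ((I.prod I).prod (I.prod I)) I
        (fun P : (M × M) × (M × M) => γ (P.1.2, P.2.2)) (discreteIdentity p) t Δ
      = parameterVariation (I.prod I) I γ p t (Δ.1.2, Δ.2.2) := by
  have h1 := hasMFDerivAt_fst (I := I.prod I) (I' := I.prod I) (x := discreteIdentity p)
  have h2 := hasMFDerivAt_snd (I := I.prod I) (I' := I.prod I) (x := discreteIdentity p)
  have h3 := (hasMFDerivAt_snd (I := I) (I' := I) (x := (p.1, p.1))).comp (discreteIdentity p) h1
  have h4 := (hasMFDerivAt_snd (I := I) (I' := I) (x := (p.2, p.2))).comp (discreteIdentity p) h2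
  have h5 := HasMFDerivAt.comp (g := fun x : M × M => γ x t) (discreteIdentity p)
    hγ.hasMFDerivAt (h3.prodMk h4)
  exact DFunLike.congr_fun h5.mfderiv Δ

variable [IsManifold I ∞ M] {O : Set (TangentBundle I M)} {W : Set (M × M)}

/-- The endpoint conditions hold on the open set `W`, so they can be differentiated; they turn
boundary terms into momenta paired with endpoint variations. -/
theorem IsBoundaryValueFamily.parameterVariation_start
    (hγ : IsBoundaryValueFamily L F h O W γ) (hp : p ∈ W) (δ : E × E) :
    parameterVariation (I.prod I) I γ p 0 δ = δ.1 := by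
  have h1 : (fun x => γ x 0) =ᶠ[𝓝 p] Prod.fst := by
    filter_upwards [hγ.isOpen_endpoints.mem_nhds hp] with x hx using hγ.start x hx
  exact DFunLike.congr_fun ((hasMFDerivAt_fst (I := I) (I' := I) (x := p)).congr_of_eventuallyEq
    h1).mfderiv δ

theorem IsBoundaryValueFamily.parameterVariation_finish
    (hγ : IsBoundaryValueFamily L F h O W γ) (hp : p ∈ W) (δ : E × E) :
    parameterVariation (I.prod I) I γ p h δ = δ.2 := by
  have h1 : (fun x => γ x h) =ᶠ[𝓝 p] Prod.snd := by
    filter_upwards [hγ.isOpen_endpoints.mem_nhds hp] with x hx using hγ.finish x hx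
  exact DFunLike.congr_fun ((hasMFDerivAt_snd (I := I) (I' := I) (x := p)).congr_of_eventuallyEq
    h1).mfderiv δ

theorem IsBoundaryValueFamily.mdifferentiableAt
    (hγ : IsBoundaryValueFamily L F h O W γ) (hp : p ∈ W) {t : ℝ} (ht : t ∈ Icc 0 h) :
    MDifferentiableAt (I.prod I) I (fun x => γ x t) p :=
  mdifferentiableAt_parameter hγ.isOpen_endpoints hp hγ.contMDiffOn ht

variable [I.Boundaryless] {R : TangentBundle I M → M} {τ : ∀ q : M, M → TangentSpace I q}
  {Z : Set (TangentBundle I M)} {U : Set (M × M)}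

/-- The generalized potential along pairs of solutions of the forced system. -/
theorem pairPotential_differential (hF : IsSmoothForce F) (hR : IsRetraction R)
    (hτ : IsLocalInverse R τ Z U) (hh : 0 < h) (hγ : IsBoundaryValueFamily L F h O W γ)
    (hp : p ∈ W) :
    MDifferentiableAt ((I.prod I).prod (I.prod I)) 𝓘(ℝ, ℝ)
        (pairPotential F τ h γ) (discreteIdentity p) ∧
      (∀ Δ : (E × E) × (E × E), IntervalIntegrable (fun t => F.toModel (velocity h (γ p) t)
        (parameterVariation (I.prod I) I γ p t (Δ.1.1, Δ.2.1)
          - parameterVariation (I.prod I) I γ p t (Δ.1.2, Δ.2.2))) MeasureTheory.volume 0 h) ∧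
      ∀ Δ : (E × E) × (E × E), differential ((I.prod I).prod (I.prod I))
        (pairPotential F τ h γ) (discreteIdentity p) Δ
        = ∫ t in (0 : ℝ)..h, F.toModel (velocity h (γ p) t)
          (parameterVariation (I.prod I) I γ p t (Δ.1.1, Δ.2.1)
            - parameterVariation (I.prod I) I γ p t (Δ.1.2, Δ.2.2)) := by
  let A : (M × M) × (M × M) → M × M := fun P => (P.1.1, P.2.1)
  let B : (M × M) × (M × M) → M × M := fun P => (P.1.2, P.2.2)
  let V : Set ((M × M) × (M × M)) := A ⁻¹' W ∩ B ⁻¹' W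
  have hV : IsOpen V := by
    refine (hγ.isOpen_endpoints.preimage ?_).inter (hγ.isOpen_endpoints.preimage ?_) <;> fun_prop
  have hA : ContMDiff ((I.prod I).prod (I.prod I)) (I.prod I) 2 A :=
    (contMDiff_fst.comp contMDiff_fst).prodMk (contMDiff_fst.comp contMDiff_snd)
  have hB : ContMDiff ((I.prod I).prod (I.prod I)) (I.prod I) 2 B :=
    (contMDiff_snd.comp contMDiff_fst).prodMk (contMDiff_snd.comp contMDiff_snd)
  have h1 : ContMDiffOn (((I.prod I).prod (I.prod I)).prod 𝓘(ℝ, ℝ)) I 2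
      (fun z : ((M × M) × (M × M)) × ℝ => γ (A z.1) z.2) (V ×ˢ Icc 0 h) :=
    hγ.contMDiffOn.comp ((hA.comp contMDiff_fst).prodMk contMDiff_snd).contMDiffOn
      fun z hz => ⟨hz.1.1, hz.2⟩
  have h2 : ContMDiffOn (((I.prod I).prod (I.prod I)).prod 𝓘(ℝ, ℝ)) I 2
      (fun z : ((M × M) × (M × M)) × ℝ => γ (B z.1) z.2) (V ×ˢ Icc 0 h) :=
    hγ.contMDiffOn.comp ((hB.comp contMDiff_fst).prodMk contMDiff_snd).contMDiffOn
      fun z hz => ⟨hz.1.2, hz.2⟩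
  obtain ⟨m1, m2, m3⟩ := hasMFDerivAt_integral_potential (J := (I.prod I).prod (I.prod I))
    (γ := fun P => γ (A P)) (γ' := fun P => γ (B P)) (p := discreteIdentity p)
    hF hR hτ hh hV ⟨hp, hp⟩ h1 h2 fun t _ => rfl
  have hvar : ∀ t ∈ Icc 0 h, ∀ Δ : (E × E) × (E × E), F.toModel (velocity h (γ p) t)
        (parameterVariation ((I.prod I).prod (I.prod I)) I (fun P => γ (A P))
            (discreteIdentity p) t Δ
          - parameterVariation ((I.prod I).prod (I.prod I)) I (fun P => γ (B P))
            (discreteIdentity p) t Δ)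
      = F.toModel (velocity h (γ p) t) (parameterVariation (I.prod I) I γ p t (Δ.1.1, Δ.2.1)
          - parameterVariation (I.prod I) I γ p t (Δ.1.2, Δ.2.2)) := fun t ht Δ => by
    have hd := hγ.mdifferentiableAt hp ht
    exact congrArg₂ (fun a b : E => F.toModel (velocity h (γ p) t) (a - b))
      (parameterVariation_firstCopy hd Δ) (parameterVariation_secondCopy hd Δ)
  have hI := uIcc_of_le hh.le
  refine ⟨m1, fun Δ => ?_, fun Δ => ?_⟩
  · refine (m2 Δ).congr fun t ht => hvar t ?_ Δ
    rw [uIoc_of_le hh.le] at ht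
    exact Ioc_subset_Icc_self ht
  · exact (m3 Δ).trans (intervalIntegral.integral_congr fun t ht => hvar t (hI ▸ ht) Δ)

/-- Varying only the first of two copies makes the work of the force the derivative of the
potential, which is already known to be integrable in time. -/
theorem intervalIntegrable_force (hF : IsSmoothForce F) (hR : IsRetraction R)
    (hτ : IsLocalInverse R τ Z U) (hh : 0 < h) (hγ : IsBoundaryValueFamily L F h O W γ)
    (hp : p ∈ W) (δ : E × E) :
    IntervalIntegrable (fun t => F.toModel (velocity h (γ p) t)
      (parameterVariation (I.prod I) I γ p t δ)) MeasureTheory.volume 0 h := by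
  have h1 := (pairPotential_differential hF hR hτ hh hγ hp).2.1 ((δ.1, 0), (δ.2, 0))
  have h2 : ((0, 0) : E × E) = 0 := rfl
  simpa [h2] using h1

theorem integral_force (hF : IsSmoothForce F) (hR : IsRetraction R)
    (hτ : IsLocalInverse R τ Z U) (hh : 0 < h) (hγ : IsBoundaryValueFamily L F h O W γ)
    (hp : p ∈ W) (a b : E) :
    ∫ t in (0 : ℝ)..h, F.toModel (velocity h (γ p) t)
        (parameterVariation (I.prod I) I γ p t (a, b))
      = exactForceMinus F h γ p a + exactForcePlus F h γ p b := by
  have hd : ∀ t ∈ Icc 0 h, MDifferentiableAt (I.prod I) I (fun x => γ x t) p := fun t ht =>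
    hγ.mdifferentiableAt hp ht
  rw [exactForceMinus_eq hh hd, exactForcePlus_eq hh hd, ← intervalIntegral.integral_add
    (intervalIntegrable_force hF hR hτ hh hγ hp _) (intervalIntegrable_force hF hR hτ hh hγ hp _)]
  refine intervalIntegral.integral_congr fun t _ => ?_
  simp only [← map_add]
  simp

theorem pairPotential_differential_eq (hF : IsSmoothForce F) (hR : IsRetraction R)
    (hτ : IsLocalInverse R τ Z U) (hh : 0 < h) (hγ : IsBoundaryValueFamily L F h O W γ)
    (hp : p ∈ W) (a A b B : E) :
    differential ((I.prod I).prod (I.prod I)) (pairPotential F τ h γ) (discreteIdentity p)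
        ((a, A), (b, B))
      = (exactForceMinus F h γ p a + exactForcePlus F h γ p b)
        - (exactForceMinus F h γ p A + exactForcePlus F h γ p B) := by
  refine ((pairPotential_differential hF hR hτ hh hγ hp).2.2 ((a, A), (b, B))).trans ?_
  rw [← integral_force hF hR hτ hh hγ hp, ← integral_force hF hR hτ hh hγ hp,
    ← intervalIntegral.integral_sub (intervalIntegrable_force hF hR hτ hh hγ hp _)
      (intervalIntegrable_force hF hR hτ hh hγ hp _)]
  simp only [map_sub]

/-- The exact discrete Lagrangian of the forced system and its partial differentials. -/
theorem exactLagrangian_differential (hL : ContMDiff I.tangent 𝓘(ℝ, ℝ) ∞ L)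
    (hF : IsSmoothForce F) (hR : IsRetraction R)
    (hτ : IsLocalInverse R τ Z U) (hh : 0 < h) (hγ : IsBoundaryValueFamily L F h O W γ)
    (hp : p ∈ W) :
    MDifferentiableAt (I.prod I) 𝓘(ℝ, ℝ) (exactLagrangian L h γ) p ∧
      (∀ a : E, D₁ I (exactLagrangian L h γ) p a + exactForceMinus F h γ p a
        = -fibreDeriv L (velocity h (γ p) 0) a) ∧
      ∀ b : E, D₂ I (exactLagrangian L h γ) p b + exactForcePlus F h γ p b
        = fibreDeriv L (velocity h (γ p) h) b := by
  obtain ⟨h1, h2⟩ := hasMFDerivAt_action (J := I.prod I) hh hγ.isOpen_endpoints hp hγ.contMDiffOn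
    (fun t _ => (hL _).of_le one_le_infty) (hγ.isSolution p hp)
    (intervalIntegrable_force hF hR hτ hh hγ hp)
  have hd : ∀ t ∈ Icc 0 h, MDifferentiableAt (I.prod I) I (fun x => γ x t) p := fun t ht =>
    hγ.mdifferentiableAt hp ht
  refine ⟨h1, fun a => ?_, fun b => ?_⟩
  · have e1 := D₁_eq_differential (G := exactLagrangian L h γ) h1 a
    -- With the final endpoint fixed only the initial momentum survives, and the work term is
    -- exactly minus `exactForceMinus`.
    have e2 := h2 (a, 0)
    rw [hγ.parameterVariation_start hp, hγ.parameterVariation_finish hp] at e2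
    rw [e1, exactForceMinus_eq hh hd]
    refine (congrArg (· + _) e2).trans ?_
    simp
  · have e1 := D₂_eq_differential (G := exactLagrangian L h γ) h1 b
    have e2 := h2 (0, b)
    rw [hγ.parameterVariation_start hp, hγ.parameterVariation_finish hp] at e2
    rw [e1, exactForcePlus_eq hh hd]
    refine (congrArg (· + _) e2).trans ?_
    simp

variable {O₂ : Set (TangentBundle (I.prod I) (M × M))} {W₂ : Set ((M × M) × (M × M))}
  {Γ : (M × M) × (M × M) → ℝ → M × M}

omit [IsManifold I ∞ M] [I.Boundaryless] in
theorem velocity_duplicate (hh : 0 < h) {c : ℝ → M} (hc : ContMDiffOn 𝓘(ℝ, ℝ) I 2 c (Icc 0 h))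
    {t : ℝ} (ht : t ∈ Icc 0 h) :
    velocity (I := I.prod I) h (fun s => (c s, c s)) t = tangentIdentity (velocity h c t) :=
  velocity_prodMk hh ht ((hc t ht).mdifferentiableWithinAt two_ne_zero)
    ((hc t ht).mdifferentiableWithinAt two_ne_zero)

/-- At the identities, the solution of the duplicated system is two copies of the solution of the
forced one. -/
theorem duplicated_solution_eq (hL : ContMDiff I.tangent 𝓘(ℝ, ℝ) ∞ L)
    (hF : IsSmoothForce F) (hR : IsRetraction R)
    (hτ : IsLocalInverse R τ Z U) (hh : 0 < h) (hγ : IsBoundaryValueFamily L F h O W γ)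
    (hΓ : IsBoundaryValueFamily (I := I.prod I) (dupLagrangian L F τ) noForce h O₂ W₂ Γ)
    (hO₂ : ∀ v ∈ O, tangentIdentity v ∈ O₂) (hp : p ∈ W) (hp₂ : discreteIdentity p ∈ W₂) :
    EqOn (Γ (discreteIdentity p)) (fun t => (γ p t, γ p t)) (Icc 0 h) := by
  -- The doubled curve is an admissible competitor: its endpoints match, and `hO₂` keeps its
  -- velocities in `O₂`.
  refine (hΓ.unique _ hp₂ _ ((hγ.isSolution p hp).duplicate hL hF hR hτ hh) ?_ ?_ ?_).symm
  · rw [hγ.start p hp]; rfl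
  · rw [hγ.finish p hp]; rfl
  · intro t ht
    rw [velocity_duplicate hh (hγ.isSolution p hp).contMDiffOn ht]
    exact hO₂ _ (hγ.velocity_mem p hp t ht)

/-- The differential at the identities of the exact discrete Lagrangian of the duplicated
system. -/
theorem exactLagrangian_dup_differential (hL : ContMDiff I.tangent 𝓘(ℝ, ℝ) ∞ L)
    (hF : IsSmoothForce F) (hR : IsRetraction R)
    (hτ : IsLocalInverse R τ Z U) (hh : 0 < h) (hγ : IsBoundaryValueFamily L F h O W γ)
    (hΓ : IsBoundaryValueFamily (I := I.prod I) (dupLagrangian L F τ) noForce h O₂ W₂ Γ)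
    (hO₂ : ∀ v ∈ O, tangentIdentity v ∈ O₂) (hp : p ∈ W) (hp₂ : discreteIdentity p ∈ W₂) :
    exactLagrangian (I := I.prod I) (dupLagrangian L F τ) h Γ (discreteIdentity p) = 0 ∧
      MDifferentiableAt ((I.prod I).prod (I.prod I)) 𝓘(ℝ, ℝ)
        (exactLagrangian (I := I.prod I) (dupLagrangian L F τ) h Γ) (discreteIdentity p) ∧
      ∀ a A b B : E, differential ((I.prod I).prod (I.prod I))
        (exactLagrangian (I := I.prod I) (dupLagrangian L F τ) h Γ) (discreteIdentity p)
          ((a, A), (b, B))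
        = (fibreDeriv L (velocity h (γ p) h) B - fibreDeriv L (velocity h (γ p) h) b)
          - (fibreDeriv L (velocity h (γ p) 0) A - fibreDeriv L (velocity h (γ p) 0) a) := by
  have heq := duplicated_solution_eq hL hF hR hτ hh hγ hΓ hO₂ hp hp₂
  have hvel : ∀ t ∈ Icc 0 h, velocity (I := I.prod I) h (Γ (discreteIdentity p)) t
      = tangentIdentity (velocity h (γ p) t) := fun t ht =>
    (velocity_congr heq ht).trans (velocity_duplicate hh (hγ.isSolution p hp).contMDiffOn ht)
  have hzero : ∀ v : TangentBundle I M, dupLagrangian L F τ (tangentIdentity v) = 0 := fun v => by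
    have h1 := potential_eq_zero (F := F) hτ hR v.proj v.2 v.2
    change L v - L v - potential F τ v v = 0
    rw [sub_self, zero_sub, neg_eq_zero]
    exact h1
  have hI := uIcc_of_le hh.le
  have h0 : (0 : ℝ) ∈ Icc 0 h := left_mem_Icc.2 hh.le
  have hh' : h ∈ Icc 0 h := right_mem_Icc.2 hh.le
  -- The action formula needs smoothness of the Lagrangian only along the central curve, which lies
  -- over the diagonal and hence in `U`; the force term is zero.
  obtain ⟨h1, h2⟩ := hasMFDerivAt_action (I := I.prod I) (J := (I.prod I).prod (I.prod I))
    (L := dupLagrangian L F τ) (F := noForce) hh hΓ.isOpen_endpoints hp₂ hΓ.contMDiffOn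
    (fun t ht => by
      rw [hvel t ht]
      have hU := (hτ.map_diag hR (γ p t)).1
      exact contMDiffAt_dupLagrangian hL hF hτ hU hU) (hΓ.isSolution _ hp₂)
    (fun δ => by
      have : ∀ w, Force.toModel (I := I.prod I) (M := M × M) noForce w = 0 := fun _ => rfl
      simp [this])
  refine ⟨?_, h1, fun a A b B => ?_⟩
  · have : exactLagrangian (I := I.prod I) (dupLagrangian L F τ) h Γ (discreteIdentity p)
        = ∫ _ in (0 : ℝ)..h, (0 : ℝ) :=
      intervalIntegral.integral_congr fun t ht => by
        simp only [hvel t (hI ▸ ht), hzero]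
    rw [this]
    simp
  · refine (h2 ((a, A), (b, B))).trans ?_
    have e0 : ∀ w, Force.toModel (I := I.prod I) (M := M × M) noForce w = 0 := fun _ => rfl
    rw [hΓ.parameterVariation_start hp₂, hΓ.parameterVariation_finish hp₂, hvel 0 h0,
      hvel h hh', fibreDeriv_dupLagrangian hL hR hτ, fibreDeriv_dupLagrangian hL hR hτ]
    simp [e0]

/-- The generalized potential along the solutions of the duplicated system. -/
theorem exactPotential_differential (hL : ContMDiff I.tangent 𝓘(ℝ, ℝ) ∞ L)
    (hF : IsSmoothForce F) (hR : IsRetraction R)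
    (hτ : IsLocalInverse R τ Z U) (hh : 0 < h) (hγ : IsBoundaryValueFamily L F h O W γ)
    (hΓ : IsBoundaryValueFamily (I := I.prod I) (dupLagrangian L F τ) noForce h O₂ W₂ Γ)
    (hO₂ : ∀ v ∈ O, tangentIdentity v ∈ O₂) (hp : p ∈ W) (hp₂ : discreteIdentity p ∈ W₂) :
    MDifferentiableAt ((I.prod I).prod (I.prod I)) 𝓘(ℝ, ℝ)
        (exactPotential F τ h Γ) (discreteIdentity p) ∧
      ∀ Δ : (E × E) × (E × E), differential ((I.prod I).prod (I.prod I))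
        (exactPotential F τ h Γ) (discreteIdentity p) Δ
        = ∫ t in (0 : ℝ)..h, F.toModel (velocity h (γ p) t)
          (variationFst I Γ (discreteIdentity p) t Δ
            - variationSnd I Γ (discreteIdentity p) t Δ) := by
  have heq := duplicated_solution_eq hL hF hR hτ hh hγ hΓ hO₂ hp hp₂
  have hfst : EqOn (fun t => (Γ (discreteIdentity p) t).1) (γ p) (Icc 0 h) := fun t ht =>
    congrArg Prod.fst (heq ht)
  have hsnd : EqOn (fun t => (Γ (discreteIdentity p) t).2) (γ p) (Icc 0 h) := fun t ht =>
    congrArg Prod.snd (heq ht)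
  obtain ⟨m1, -, m3⟩ := hasMFDerivAt_integral_potential (J := (I.prod I).prod (I.prod I))
    (γ := fun P t => (Γ P t).1) (γ' := fun P t => (Γ P t).2) (p := discreteIdentity p)
    hF hR hτ hh hΓ.isOpen_endpoints hp₂ (contMDiff_fst.comp_contMDiffOn hΓ.contMDiffOn)
    (contMDiff_snd.comp_contMDiffOn hΓ.contMDiffOn) (hfst.trans hsnd.symm)
  refine ⟨m1, fun Δ => (m3 Δ).trans (intervalIntegral.integral_congr fun t ht => ?_)⟩
  rw [uIcc_of_le hh.le] at ht
  simp only [velocity_congr hfst ht]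
  rfl

/-- The discrete Euler-Lagrange equations of the duplicated system at the identities. -/
theorem freeDEL_dup_eq (hL : ContMDiff I.tangent 𝓘(ℝ, ℝ) ∞ L)
    (hF : IsSmoothForce F) (hR : IsRetraction R)
    (hτ : IsLocalInverse R τ Z U) (hh : 0 < h) (hγ : IsBoundaryValueFamily L F h O W γ)
    (hΓ : IsBoundaryValueFamily (I := I.prod I) (dupLagrangian L F τ) noForce h O₂ W₂ Γ)
    (hO₂ : ∀ v ∈ O, tangentIdentity v ∈ O₂) (hW₂ : ∀ p ∈ W, discreteIdentity p ∈ W₂)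
    {x y z : M} (hxy : (x, y) ∈ W) (hyz : (y, z) ∈ W) (a A : E) :
    freeDEL (I.prod I) (exactLagrangian (I := I.prod I) (dupLagrangian L F τ) h Γ)
        (x, x) (y, y) (z, z) (a, A)
      = forcedDEL (I := I) (exactLagrangian L h γ)
          (exactForceMinus F h γ) (exactForcePlus F h γ) x y z A
        - forcedDEL (I := I) (exactLagrangian L h γ)
          (exactForceMinus F h γ) (exactForcePlus F h γ) x y z a := by
  obtain ⟨-, d1, f1⟩ := exactLagrangian_dup_differential hL hF hR hτ hh hγ hΓ hO₂ hyz
    (hW₂ _ hyz)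
  obtain ⟨-, d2, f2⟩ := exactLagrangian_dup_differential hL hF hR hτ hh hγ hΓ hO₂ hxy
    (hW₂ _ hxy)
  obtain ⟨-, g1, -⟩ := exactLagrangian_differential hL hF hR hτ hh hγ hyz
  obtain ⟨-, -, g2⟩ := exactLagrangian_differential hL hF hR hτ hh hγ hxy
  -- The middle point is the initial endpoint of the segment to `z` and the final endpoint of the
  -- segment from `x`; the outer endpoints are held fixed.
  have e1 := (D₁_eq_differential (I := I.prod I) (p := ((y, y), (z, z))) d1 (a, A)).trans
    (f1 a A 0 0)
  have e2 := (D₂_eq_differential (I := I.prod I) (p := ((x, x), (y, y))) d2 (a, A)).trans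
    (f2 0 0 a A)
  have k1 := g1 a
  have k2 := g1 A
  have k3 := g2 a
  have k4 := g2 A
  unfold forcedDEL
  refine (congrArg₂ (· + ·) e1 e2).trans ?_
  simp only [map_zero, sub_zero, zero_sub, sub_self] at *
  linarith

-- The discrete forces are plain functions of δ, so vanishing at 0 is not automatic. It serves to
-- isolate one copy in the discrete equations.
omit [IsManifold I ∞ M] [I.Boundaryless] in
theorem exactForceMinus_zero : exactForceMinus F h γ p 0 = 0 :=
  (intervalIntegral.integral_congr (g := fun _ => 0) fun t _ =>
    (congrArg (F (velocity h (γ p) t)) (map_zero _)).trans (map_zero _)).trans (by simp)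

omit [IsManifold I ∞ M] [I.Boundaryless] in
theorem exactForcePlus_zero : exactForcePlus F h γ p 0 = 0 :=
  (intervalIntegral.integral_congr (g := fun _ => 0) fun t _ =>
    (congrArg (F (velocity h (γ p) t)) (map_zero _)).trans (map_zero _)).trans (by simp)

omit [IsManifold I ∞ M] [I.Boundaryless] in
theorem forcedDEL_zero {x y z : M} :
    forcedDEL (I := I) (exactLagrangian L h γ)
      (exactForceMinus F h γ) (exactForcePlus F h γ) x y z 0 = 0 := by
  rw [forcedDEL, exactForceMinus_zero (p := (y, z)), exactForcePlus_zero (p := (x, y))]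
  simp only [D₁, D₂, differential, map_zero, add_zero]
  exact add_zero (0 : ℝ)

end BoundaryValue

end ForcedLagrangian

/-! ### Assembly of the proposition. -/

theorem mainTheorem9
    {E : Type*} [NormedAddCommGroup E] [NormedSpace ℝ E] [FiniteDimensional ℝ E]
    {Q : Type*} [TopologicalSpace Q] [T2Space Q] [SecondCountableTopology Q]
    [ChartedSpace E Q] [IsManifold 𝓘(ℝ, E) ∞ Q]
    -- the regular forced Lagrangian system `(L, F)`
    (L : TangentBundle 𝓘(ℝ, E) Q → ℝ)
    (hL : ContMDiff 𝓘(ℝ, E).tangent 𝓘(ℝ, ℝ) ∞ L)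
    (hreg : IsRegularLagrangian L)
    (F : Force 𝓘(ℝ, E) Q)
    (hF : IsSmoothForce F)
    -- the retraction and the local inverse `τ` that define `K̃_F`
    (R : TangentBundle 𝓘(ℝ, E) Q → Q)
    (hR : IsRetraction R)
    (τ : ∀ q : Q, Q → TangentSpace 𝓘(ℝ, E) q)
    (Z : Set (TangentBundle 𝓘(ℝ, E) Q)) (U : Set (Q × Q))
    (hτ : IsLocalInverse R τ Z U)
    (h : ℝ) (hh : 0 < h)
    -- the boundary value problem of the forced system
    (O : Set (TangentBundle 𝓘(ℝ, E) Q)) (W : Set (Q × Q)) (γ : Q × Q → ℝ → Q)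
    (hγ : IsBoundaryValueFamily L F h O W γ)
    -- the boundary value problem of the duplicated system, around the identities
    (O₂ : Set (TangentBundle (𝓘(ℝ, E).prod 𝓘(ℝ, E)) (Q × Q)))
    (W₂ : Set ((Q × Q) × (Q × Q))) (Γ : (Q × Q) × (Q × Q) → ℝ → Q × Q)
    (hΓ : IsBoundaryValueFamily (dupLagrangian L F τ)
      noForce h O₂ W₂ Γ)
    (hO₂ : ∀ v ∈ O, tangentIdentity v ∈ O₂)
    (hW₂ : ∀ p ∈ W, discreteIdentity p ∈ W₂)
    (hU : ∀ w ∈ O₂, (w.proj.1, w.proj.2) ∈ U ∧ (w.proj.2, w.proj.1) ∈ U) :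
    (∀ p ∈ W,
      -- at the identities the duplicated solution is two copies of the forced one
      (∀ t ∈ Set.Icc (0 : ℝ) h,
        Γ (discreteIdentity p) t = (γ p t, γ p t)) ∧
      exactLagrangian (dupLagrangian L F τ) h Γ
        (discreteIdentity p) = 0 ∧
      -- the differential at the identities is two copies, with opposite signs, of
      -- `dL_d^e + f_d^{e-} + f_d^{e+}`
      MDifferentiableAt (𝓘(ℝ, E).prod 𝓘(ℝ, E)) 𝓘(ℝ, ℝ)
        (exactLagrangian L h γ) p ∧
      MDifferentiableAt ((𝓘(ℝ, E).prod 𝓘(ℝ, E)).prod (𝓘(ℝ, E).prod 𝓘(ℝ, E))) 𝓘(ℝ, ℝ)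
        (exactLagrangian (dupLagrangian L F τ) h Γ)
        (discreteIdentity p) ∧
      (∀ (a A : TangentSpace 𝓘(ℝ, E) p.1) (b B : TangentSpace 𝓘(ℝ, E) p.2),
        differential ((𝓘(ℝ, E).prod 𝓘(ℝ, E)).prod (𝓘(ℝ, E).prod 𝓘(ℝ, E)))
          (exactLagrangian (dupLagrangian L F τ) h Γ)
          (discreteIdentity p) ((a, A), (b, B)) =
        (D₁ 𝓘(ℝ, E) (exactLagrangian L h γ) p A
            + exactForceMinus F h γ p A
          + D₂ 𝓘(ℝ, E) (exactLagrangian L h γ) p B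
            + exactForcePlus F h γ p B)
        - (D₁ 𝓘(ℝ, E) (exactLagrangian L h γ) p a
            + exactForceMinus F h γ p a
          + D₂ 𝓘(ℝ, E) (exactLagrangian L h γ) p b
            + exactForcePlus F h γ p b)) ∧
      -- `K̃_F`, along pairs of solutions of the forced system, generates the exact discrete forces
      MDifferentiableAt ((𝓘(ℝ, E).prod 𝓘(ℝ, E)).prod (𝓘(ℝ, E).prod 𝓘(ℝ, E))) 𝓘(ℝ, ℝ)
        (pairPotential F τ h γ) (discreteIdentity p) ∧
      (∀ (a A : TangentSpace 𝓘(ℝ, E) p.1) (b B : TangentSpace 𝓘(ℝ, E) p.2),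
        differential ((𝓘(ℝ, E).prod 𝓘(ℝ, E)).prod (𝓘(ℝ, E).prod 𝓘(ℝ, E)))
          (pairPotential F τ h γ)
          (discreteIdentity p) ((a, A), (b, B)) =
        (exactForceMinus F h γ p a + exactForcePlus F h γ p b)
        - (exactForceMinus F h γ p A
            + exactForcePlus F h γ p B)) ∧
      -- `K̃_F`, along the solutions of the duplicated system
      MDifferentiableAt ((𝓘(ℝ, E).prod 𝓘(ℝ, E)).prod (𝓘(ℝ, E).prod 𝓘(ℝ, E))) 𝓘(ℝ, ℝ)
        (exactPotential F τ h Γ) (discreteIdentity p) ∧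
      (∀ Δ : TangentSpace ((𝓘(ℝ, E).prod 𝓘(ℝ, E)).prod (𝓘(ℝ, E).prod 𝓘(ℝ, E)))
          (discreteIdentity p),
        differential ((𝓘(ℝ, E).prod 𝓘(ℝ, E)).prod (𝓘(ℝ, E).prod 𝓘(ℝ, E)))
          (exactPotential F τ h Γ) (discreteIdentity p) Δ =
        ∫ t in (0 : ℝ)..h, F.toModel (velocity h (γ p) t)
          (variationFst 𝓘(ℝ, E) Γ (discreteIdentity p) t Δ
            - variationSnd 𝓘(ℝ, E) Γ (discreteIdentity p) t Δ))) ∧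
    -- the discrete equations at the identities are two copies, with opposite signs, of the
    -- forced discrete Euler-Lagrange equations
    (∀ x y z : Q, (x, y) ∈ W → (y, z) ∈ W → ∀ a A : TangentSpace 𝓘(ℝ, E) y,
      freeDEL (𝓘(ℝ, E).prod 𝓘(ℝ, E))
        (exactLagrangian (dupLagrangian L F τ) h Γ)
        (x, x) (y, y) (z, z) (a, A) =
      forcedDEL (exactLagrangian L h γ)
          (exactForceMinus F h γ) (exactForcePlus F h γ) x y z A
      - forcedDEL (exactLagrangian L h γ)
          (exactForceMinus F h γ) (exactForcePlus F h γ)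
          x y z a) ∧
    (∀ (n : ℕ) (q : ℕ → Q), (∀ k < n, (q k, q (k + 1)) ∈ W) →
      ((∀ k, k + 2 ≤ n → ∀ δ : TangentSpace (𝓘(ℝ, E).prod 𝓘(ℝ, E)) (q (k + 1), q (k + 1)),
        freeDEL (𝓘(ℝ, E).prod 𝓘(ℝ, E))
          (exactLagrangian (dupLagrangian L F τ) h Γ)
          (q k, q k) (q (k + 1), q (k + 1)) (q (k + 2), q (k + 2)) δ = 0) ↔
      (∀ k, k + 2 ≤ n → ∀ δ : TangentSpace 𝓘(ℝ, E) (q (k + 1)),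
        forcedDEL (exactLagrangian L h γ)
          (exactForceMinus F h γ) (exactForcePlus F h γ)
          (q k) (q (k + 1)) (q (k + 2)) δ = 0))) := by
  have hI : ∀ p ∈ W, _ := fun p hp =>
    exactLagrangian_differential hL hF hR hτ hh hγ hp
  have hdup : ∀ p ∈ W, _ := fun p hp =>
    exactLagrangian_dup_differential hL hF hR hτ hh hγ hΓ hO₂ hp (hW₂ p hp)
  have hDEL : ∀ x y z : Q, (x, y) ∈ W → (y, z) ∈ W → ∀ a A : E, _ := fun x y z hxy hyz a A =>
    freeDEL_dup_eq hL hF hR hτ hh hγ hΓ hO₂ hW₂ hxy hyz a A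
  refine ⟨fun p hp => ?_, hDEL, fun n q hq => ⟨fun hfree k hk δ => ?_, fun hforced k hk δ => ?_⟩⟩
  · obtain ⟨d1, g1, g2⟩ := hI p hp
    obtain ⟨e1, e2, e3⟩ := hdup p hp
    have hpot := exactPotential_differential hL hF hR hτ hh hγ hΓ hO₂ hp (hW₂ p hp)
    have hpair : ∀ a A b B : E, _ := pairPotential_differential_eq hF hR hτ hh hγ hp
    refine ⟨duplicated_solution_eq hL hF hR hτ hh hγ hΓ hO₂ hp (hW₂ p hp), e1, d1, e2,
      fun a A b B => ?_, (pairPotential_differential hF hR hτ hh hγ hp).1,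
      hpair, hpot.1, hpot.2⟩
    -- Both differentials are now written in boundary momenta, so the comparison is linear
    -- arithmetic.
    refine (e3 a A b B).trans ?_
    have k1 := g1 a
    have k2 := g1 A
    have k3 := g2 b
    have k4 := g2 B
    linarith
  -- Testing with (0, δ) removes the first copy and leaves the forced equation with a plus sign. The
  -- bound `k + 2 ≤ n` puts both adjacent pairs in `W`.
  · have h1 := hDEL _ _ _ (hq k (by omega)) (hq (k + 1) (by omega)) 0 δ
    have h2 := hfree k hk ((0 : E), δ)
    have h3 := h1.symm.trans h2
    rw [sub_eq_zero] at h3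
    exact h3.trans forcedDEL_zero
  · have h1 := hDEL _ _ _ (hq k (by omega)) (hq (k + 1) (by omega)) δ.1 δ.2
    refine h1.trans ?_
    have h2 := hforced k hk δ.1
    have h3 := hforced k hk δ.2
    exact (congrArg₂ (· - ·) h3 h2).trans (sub_zero 0)
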